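/- For $x>0$ let $\Gamma_q(x)$ be the $q$-gamma function, i.e. $\Gamma_q(x)=(1-q)^{1-x}\prod_{n\ge 0}\frac{1-q^{n+1}}{1-q^{n+x}}$ for $0<q<1$, $\Gamma_q(x)=(q-1)^{1-x}q^{x(x-1)/2}\prod_{n\ge 0}\frac{1-q^{-(n+1)}}{1-q^{-(n+x)}}$ for $q>1$, and $\Gamma_1=\Gamma$ (Euler's gamma function). Let $\psi_q=\Gamma_q'/\Gamma_q$ (derivative in $x$), and put $$J=\{q>0:\ \psi_q(1)-\psi_q(1)^2+\psi_q'(1)\ge 0\}.$$ For $q,x,\alpha>0$ let $$f_q(x)=\frac{\Gamma_q(x)\Gamma_q(1/x)}{\Gamma_q(x)+\Gamma_q(1/x)},\qquad g_{q,x}(\alpha)=f_q(x^\alpha).$$ Then $(0,4]\subset J$, and the following hold. (1) Let $q\in J$. Then $f_q$ is strictly decreasing on $(0,1]$ and strictly increasing on $[1,\infty)$. For every $x>0$ the function $g_{q,x}$ is non-decreasing on $(0,\infty)$, strictly increasing if $x\ne 1$. In particular, for every $x>0$, $$2\,\frac{\Gamma_q(x)\Gamma_q(1/x)}{\Gamma_q(x)+\Gamma_q(1/x)}\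 \ge\ 1,$$ with equality if and only if $x=1$. (2) Let $q>0$, $q\notin J$. Then $\psi_q$ has a unique positive zero $x_q$, and there is $y_q\in(1,x_q)$ such that $f_q$ is strictly decreasing on each of the intervals $(0,1/y_q]$ and $[1,y_q]$ and strictly increasing on each of the intervals $[1/y_q,1]$ and $[y_q,\infty)$. For every $x>0$ the function $g_{q,x}$ is non-increasing on the set of those $\alpha>0$ with $x^\alpha\in[1/y_q,y_q]$, and non-decreasing on the set of those $\alpha>0$ with $x^\alpha\in(0,1/y_q]\cup[y_q,\infty)$; if $x\neq1$ (when these sets are the intervals $(0,\tau]$ and $[\tau,\infty)$ with $\tau=\log y_q/|\log x|$) the monotonicity is strict. In particular, $f_q(x)\ge f_q(y_q)$ for every $x>0$. -/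

import Mathlib

open Set

noncomputable section

/-- The `q`-gamma function `Γ_q(x)`, meant for `q > 0` and `x > 0`; at `q = 1` it is Euler's gamma
function, the limit of `Γ_q(x)` as `q → 1`. -/
def qGamma (q x : ℝ) : ℝ :=
  if q < 1 then
    (1 - q) ^ (1 - x) * ∏' n : ℕ, (1 - q ^ ((n : ℝ) + 1)) / (1 - q ^ ((n : ℝ) + x))
  else if q = 1 then
    Real.Gamma x
  else
    (q - 1) ^ (1 - x) * q ^ (x * (x - 1) / 2) *
      ∏' n : ℕ, (1 - q ^ (-((n : ℝ) + 1))) / (1 - q ^ (-((n : ℝ) + x)))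

/-- The `q`-digamma function `ψ_q(x) = Γ_q'(x) / Γ_q(x)`, with derivatives taken in `x`. -/
def qDigamma (q x : ℝ) : ℝ :=
  deriv (qGamma q) x / qGamma q x

/-- The set `J` of all `q > 0` such that `ψ_q(1) - ψ_q(1)² + ψ_q'(1) ≥ 0`. -/
def setJ : Set ℝ :=
  {q : ℝ | 0 < q ∧ 0 ≤ qDigamma q 1 - (qDigamma q 1) ^ 2 + deriv (qDigamma q) 1}

/-- `f_q(x) = Γ_q(x) Γ_q(1/x) / (Γ_q(x) + Γ_q(1/x))`, half of the harmonic mean. -/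
def fq (q x : ℝ) : ℝ :=
  qGamma q x * qGamma q (1 / x) / (qGamma q x + qGamma q (1 / x))

/-- `g_{q,x}(α) = f_q(x^α)`. -/
def gq (q x α : ℝ) : ℝ :=
  fq q (x ^ α)

/-- `z` is the unique positive zero `x_q` of `ψ_q`. -/
def IsPosZero (q z : ℝ) : Prop :=
  0 < z ∧ qDigamma q z = 0 ∧ ∀ x : ℝ, 0 < x → qDigamma q x = 0 → x = z

end

/-!
For `G = Γ_q` write `ψ = G' / G` and `θ(x) = x ψ(x) / G(x)`. Since `1 / f_q(x)` equals
`1 / G(x) + 1 / G(1/x)` and has derivative `-(θ(x) - θ(1/x)) / x`, everything depends on the sign of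
`θ(x) - θ(1/x)` for `x > 1`; the range `x < 1` and the functions `g_{q,x}` follow by the symmetry
`f_q(1/x) = f_q(x)`.

The function `ψ` is increasing and concave, and `G(1) = G(2)`. So it has a unique zero `z`, with
`1 < z ≤ 3/2`, and for `x ≥ z` the sign is plain: `θ(1/x) < 0 ≤ θ(x)`. On `(1, z)` both values of
`θ` are negative, and `log |θ(x)| - log |θ(1/x)|` has derivative `(κ(x) + κ(1/x)) / x`, where
`κ(x) = 1 - N(x) - x ψ(x)` and `N(x) = -x ψ'(x) / ψ(x)`. Concavity and `ψ(3/2) ≥ 0` give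
`N(x) ≥ x / (3/2 - x)`, whence `N(x) + N(1/x) ≥ 4` (`IsGammaLike.four_le_elasticity_add`).

For `q ≤ 1` the recurrence of `ψ` gives `x ψ(x) > -1` for `x > 1/2`, hence `κ(x) + κ(1/x) < 0`,
and the sign is positive throughout (`IsGammaLike.theta_lt_of_neg_one_lt`).

For `q > 1` there are two more facts: `ψ'` is logarithmically convex (Cauchy-Schwarz), and `x ψ(x)`
is convex for `x ≥ 2/3` (`convex_mul_qPsiAux`). They imply that `κ(x) + κ(1/x)` is strictly
decreasing on `[1, z)` (`IsConvexGammaLike.strictAntiOn_kappa_add`). Its value at `1` is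
`2 (ψ(1) - ψ(1)² + ψ'(1)) / ψ(1)` with `ψ(1) < 0`, so it is non-positive exactly when `q ∈ J`. In
that case the sign of `θ(x) - θ(1/x)` is positive; otherwise it changes exactly once, from negative to
positive, at a point of `(1, z)` (`IsConvexGammaLike.exists_theta_sign_change`).

For `q ≠ 1` all these properties are read off the series `∑ e^{-kλx} / (k (1 - e^{-kλ}))`,
`λ = |log q|`, and for `q = 1` off Weierstrass' product. Finally `(0, 4] ⊆ J`: for `q ≤ 1` because
`|ψ(1)| ≤ ψ'(1) / 2` and `|ψ(1)| < 1`, and for `1 < q ≤ 4` by termwise bounds for the series, which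
reduce the claim to `L (3 cosh L + 1) ≤ 6 sinh L` with `L = log q`.
-/

/-! ### Symmetrisation under inversion -/

/-- If `f` has logarithmic derivative `g` (that is, `x f'(x) = g x`), then `f x - f (1/x)` has
logarithmic derivative `g x + g (1/x)`. -/
lemma HasDerivAt.sub_comp_inv {f g : ℝ → ℝ} {x : ℝ} (hx : 0 < x)
    (h : HasDerivAt f (g x / x) x) (h' : HasDerivAt f (g (1 / x) / (1 / x)) (1 / x)) :
    HasDerivAt (fun s => f s - f (1 / s)) ((g x + g (1 / x)) / x) x := by
  have hi : HasDerivAt (fun s : ℝ => 1 / s) (-(x ^ 2)⁻¹) x := by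
    simpa using hasDerivAt_inv hx.ne'
  convert! h.sub (h'.comp x hi) using 1
  field_simp
  ring

/-- If `x f'(x) = g x`, then `f x + f (1/x)` has logarithmic derivative `g x - g (1/x)`. -/
lemma HasDerivAt.add_comp_inv {f g : ℝ → ℝ} {x : ℝ} (hx : 0 < x)
    (h : HasDerivAt f (g x / x) x) (h' : HasDerivAt f (g (1 / x) / (1 / x)) (1 / x)) :
    HasDerivAt (fun s => f s + f (1 / s)) ((g x - g (1 / x)) / x) x := by
  have hi : HasDerivAt (fun s : ℝ => 1 / s) (-(x ^ 2)⁻¹) x := by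
    simpa using hasDerivAt_inv hx.ne'
  convert! h.add (h'.comp x hi) using 1
  field_simp
  ring

lemma one_div_mem_Ioo_of_mem_Ico {b x : ℝ} (hx : x ∈ Ico 1 b) :
    1 / x ∈ Ioo (1 / b) b ∧ x ∈ Ioo (1 / b) b ∧ 0 < x := by
  obtain ⟨h1, h2⟩ := hx
  have h0 : 0 < x := by linarith
  have hb : 1 / b < 1 / x := one_div_lt_one_div_of_lt h0 h2
  have h3 : 1 / x ≤ 1 := by rw [div_le_one h0]; exact h1
  exact ⟨⟨hb, by linarith⟩, ⟨by linarith, h2⟩, h0⟩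

lemma strictMonoOn_sub_comp_inv {f g : ℝ → ℝ} {b : ℝ}
    (hf : ∀ x ∈ Ioo (1 / b) b, HasDerivAt f (g x / x) x)
    (hg : ∀ x ∈ Ioo 1 b, 0 < g x + g (1 / x)) :
    StrictMonoOn (fun x => f x - f (1 / x)) (Ico 1 b) := by
  have key : ∀ x ∈ Ico 1 b,
      HasDerivAt (fun s => f s - f (1 / s)) ((g x + g (1 / x)) / x) x := fun x hx =>
    have h := one_div_mem_Ioo_of_mem_Ico hx
    HasDerivAt.sub_comp_inv h.2.2 (hf x h.2.1) (hf _ h.1)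
  refine strictMonoOn_of_deriv_pos (convex_Ico 1 b)
    (fun x hx => (key x hx).continuousAt.continuousWithinAt) fun x hx => ?_
  rw [interior_Ico] at hx
  rw [(key x ⟨hx.1.le, hx.2⟩).deriv]
  exact div_pos (hg x hx) (by linarith [hx.1])

lemma monotoneOn_sub_comp_inv {f g : ℝ → ℝ} {b : ℝ}
    (hf : ∀ x ∈ Ioo (1 / b) b, HasDerivAt f (g x / x) x)
    (hg : ∀ x ∈ Ioo 1 b, 0 ≤ g x + g (1 / x)) :
    MonotoneOn (fun x => f x - f (1 / x)) (Ico 1 b) := by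
  have key : ∀ x ∈ Ico 1 b,
      HasDerivAt (fun s => f s - f (1 / s)) ((g x + g (1 / x)) / x) x := fun x hx =>
    have h := one_div_mem_Ioo_of_mem_Ico hx
    HasDerivAt.sub_comp_inv h.2.2 (hf x h.2.1) (hf _ h.1)
  refine monotoneOn_of_deriv_nonneg (convex_Ico 1 b)
    (fun x hx => (key x hx).continuousAt.continuousWithinAt)
    (fun x hx => (key x (interior_subset hx)).differentiableAt.differentiableWithinAt)
    fun x hx => ?_
  rw [interior_Ico] at hx
  rw [(key x ⟨hx.1.le, hx.2⟩).deriv]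
  exact div_nonneg (hg x hx) (by linarith [hx.1])

lemma strictMonoOn_add_comp_inv {f g : ℝ → ℝ} {b : ℝ}
    (hf : ∀ x ∈ Ioo (1 / b) b, HasDerivAt f (g x / x) x)
    (hg : ∀ x ∈ Ioo 1 b, g (1 / x) < g x) :
    StrictMonoOn (fun x => f x + f (1 / x)) (Ico 1 b) := by
  have key : ∀ x ∈ Ico 1 b,
      HasDerivAt (fun s => f s + f (1 / s)) ((g x - g (1 / x)) / x) x := fun x hx =>
    have h := one_div_mem_Ioo_of_mem_Ico hx
    HasDerivAt.add_comp_inv h.2.2 (hf x h.2.1) (hf _ h.1)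
  refine strictMonoOn_of_deriv_pos (convex_Ico 1 b)
    (fun x hx => (key x hx).continuousAt.continuousWithinAt) fun x hx => ?_
  rw [interior_Ico] at hx
  rw [(key x ⟨hx.1.le, hx.2⟩).deriv]
  exact div_pos (sub_pos.2 (hg x hx)) (by linarith [hx.1])

/-- The logarithmic derivative `-x f'(x) / f(x)` of `1 / f` with respect to `log x`, where `f'` is
passed as a separate argument. -/
noncomputable def elasticity (f f' : ℝ → ℝ) (x : ℝ) : ℝ :=
  -(x * f' x) / f x

lemma hasDerivAt_elasticity {f f' f'' : ℝ → ℝ} {x : ℝ} (hx : 0 < x) (hf : HasDerivAt f (f' x) x)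
    (hf' : HasDerivAt f' (f'' x) x) (h0 : f x ≠ 0) :
    HasDerivAt (elasticity f f')
      ((elasticity f f' x * (1 + elasticity f f' x) - x ^ 2 * f'' x / f x) / x) x := by
  have := ((hasDerivAt_id x).mul hf').neg.div hf h0
  convert! this using 1
  simp only [id, elasticity, Pi.neg_apply, Pi.mul_apply]
  field_simp
  ring

/-! ### Functions with the basic properties of a gamma function -/

/-- The properties shared by all `q`-gamma functions: `G` is positive on `(0, ∞)`, has logarithmic
derivative `ψ`, which is increasing and concave with derivative `ψ₁`, and `G 1 = G 2 = 1`. -/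
structure IsGammaLike (G ψ ψ₁ : ℝ → ℝ) : Prop where
  pos : ∀ x, 0 < x → 0 < G x
  hasDerivAt : ∀ x, 0 < x → HasDerivAt G (G x * ψ x) x
  hasDerivAt_psi : ∀ x, 0 < x → HasDerivAt ψ (ψ₁ x) x
  psi₁_pos : ∀ x, 0 < x → 0 < ψ₁ x
  psi₁_anti : ∀ x y, 0 < x → x ≤ y → ψ₁ y ≤ ψ₁ x
  one : G 1 = 1
  two : G 2 = 1

namespace IsGammaLike

variable {G ψ ψ₁ : ℝ → ℝ}

lemma strictMonoOn_psi (h : IsGammaLike G ψ ψ₁) : StrictMonoOn ψ (Ioi 0) := by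
  refine strictMonoOn_of_deriv_pos (convex_Ioi 0)
    (fun x hx => (h.hasDerivAt_psi x hx).continuousAt.continuousWithinAt) fun x hx => ?_
  rw [interior_Ioi] at hx
  rw [(h.hasDerivAt_psi x hx).deriv]
  exact h.psi₁_pos x hx

lemma hasDerivAt_log (h : IsGammaLike G ψ ψ₁) {x : ℝ} (hx : 0 < x) :
    HasDerivAt (fun s => Real.log (G s)) (ψ x) x := by
  have := (h.hasDerivAt x hx).log (h.pos x hx).ne'
  rwa [mul_div_cancel_left₀ _ (h.pos x hx).ne'] at this

/-- Concavity of `ψ`: its graph lies below its tangents. -/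
lemma psi_le_tangent (h : IsGammaLike G ψ ψ₁) {x a : ℝ} (hx : 0 < x) (ha : 0 < a) :
    ψ x ≤ ψ a + (x - a) * ψ₁ a := by
  have hd : ∀ s, 0 < s → HasDerivAt (fun s => ψ s - s * ψ₁ a) (ψ₁ s - 1 * ψ₁ a) s := fun s hs =>
    (h.hasDerivAt_psi s hs).sub ((hasDerivAt_id s).mul_const _)
  rcases le_total x a with hxa | hxa
  · have : MonotoneOn (fun s => ψ s - s * ψ₁ a) (Icc x a) := by
      refine monotoneOn_of_deriv_nonneg (convex_Icc x a)
        (fun s hs => (hd s (hx.trans_le hs.1)).continuousAt.continuousWithinAt)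
        (fun s hs => (hd s (hx.trans_le
          (interior_subset hs).1)).differentiableAt.differentiableWithinAt) fun s hs => ?_
      have hs' := interior_subset hs
      rw [(hd s (hx.trans_le hs'.1)).deriv]
      linarith [h.psi₁_anti s a (hx.trans_le hs'.1) hs'.2]
    have := this (left_mem_Icc.2 hxa) (right_mem_Icc.2 hxa) hxa
    simp only at this
    linarith
  · have : AntitoneOn (fun s => ψ s - s * ψ₁ a) (Icc a x) := by
      refine antitoneOn_of_deriv_nonpos (convex_Icc a x)
        (fun s hs => (hd s (ha.trans_le hs.1)).continuousAt.continuousWithinAt)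
        (fun s hs => (hd s (ha.trans_le
          (interior_subset hs).1)).differentiableAt.differentiableWithinAt) fun s hs => ?_
      have hs' := interior_subset hs
      rw [(hd s (ha.trans_le hs'.1)).deriv]
      linarith [h.psi₁_anti a s ha hs'.1]
    have := this (left_mem_Icc.2 hxa) (right_mem_Icc.2 hxa) hxa
    simp only at this
    linarith

/-- Since `ψ` is concave and `∫ ψ` over `[1, 2]` vanishes, `ψ` is non-negative at the midpoint. -/
lemma psi_three_halves_nonneg (h : IsGammaLike G ψ ψ₁) : 0 ≤ ψ (3 / 2) := by
  set F : ℝ → ℝ := fun s => Real.log (G s) - ψ (3 / 2) * (s - 3 / 2)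
    - ψ₁ (3 / 2) * (s - 3 / 2) ^ 2 / 2 with hF
  have hd : ∀ s, 0 < s →
      HasDerivAt F (ψ s - ψ (3 / 2) - ψ₁ (3 / 2) * (s - 3 / 2)) s := fun s hs => by
    have h1 : HasDerivAt (fun s : ℝ => s - 3 / 2) 1 s := (hasDerivAt_id s).sub_const _
    convert! ((h.hasDerivAt_log hs).sub (h1.const_mul (ψ (3 / 2)))).sub
      (((h1.pow 2).const_mul (ψ₁ (3 / 2))).div_const 2) using 1
    simp
    ring
  have : AntitoneOn F (Icc 1 2) := by
    have h0 : ∀ s ∈ Icc (1 : ℝ) 2, 0 < s := fun s hs => by linarith [hs.1]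
    refine antitoneOn_of_deriv_nonpos (convex_Icc 1 2)
      (fun s hs => (hd s (h0 s hs)).continuousAt.continuousWithinAt)
      (fun s hs => (hd s (h0 s (interior_subset hs))).differentiableAt.differentiableWithinAt)
      fun s hs => ?_
    have hs' := h0 s (interior_subset hs)
    rw [(hd s hs').deriv]
    linarith [h.psi_le_tangent hs' (a := 3 / 2) (by norm_num)]
  have := this (left_mem_Icc.2 (by norm_num)) (right_mem_Icc.2 (by norm_num)) (by norm_num)
  simp only [hF, h.one, h.two, Real.log_one] at this
  linarith

/-- By Rolle's theorem, as `G 1 = G 2`. -/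
lemma exists_zero (h : IsGammaLike G ψ ψ₁) : ∃ z, 1 < z ∧ z ≤ 3 / 2 ∧ ψ z = 0 := by
  obtain ⟨c, hc, hc0⟩ := exists_hasDerivAt_eq_zero (f := fun s => Real.log (G s)) (f' := ψ)
    (a := 1) (b := 2) one_lt_two
    (fun s hs => (h.hasDerivAt_log (by linarith [hs.1])).continuousAt.continuousWithinAt)
    (by simp [h.one, h.two]) (fun s hs => h.hasDerivAt_log (by linarith [hs.1]))
  refine ⟨c, hc.1, ?_, hc0⟩
  refine (h.strictMonoOn_psi.le_iff_le (mem_Ioi.2 (by linarith [hc.1]))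
    (mem_Ioi.2 (by norm_num))).1 ?_
  rw [hc0]
  exact h.psi_three_halves_nonneg

lemma psi_neg (h : IsGammaLike G ψ ψ₁) {x z : ℝ} (hz : ψ z = 0) (hx : 0 < x) (hxz : x < z) :
    ψ x < 0 := by
  rw [← hz]
  exact h.strictMonoOn_psi hx (hx.trans hxz) hxz

lemma psi_pos (h : IsGammaLike G ψ ψ₁) {x z : ℝ} (hz : ψ z = 0) (hz0 : 0 < z) (hxz : z < x) :
    0 < ψ x := by
  rw [← hz]
  exact h.strictMonoOn_psi hz0 (hz0.trans hxz) hxz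

lemma neg_psi_le (h : IsGammaLike G ψ ψ₁) {x : ℝ} (hx : 0 < x) :
    -ψ x ≤ (3 / 2 - x) * ψ₁ x := by
  have := h.psi_le_tangent (x := 3 / 2) (by norm_num) hx
  linarith [h.psi_three_halves_nonneg]

/-- The elasticity of `ψ` is bounded below by that of an affine function vanishing at `3/2`. -/
lemma le_elasticity (h : IsGammaLike G ψ ψ₁) {x z : ℝ} (hz : ψ z = 0) (hz' : z ≤ 3 / 2)
    (hx : 0 < x) (hxz : x < z) : x / (3 / 2 - x) ≤ elasticity ψ ψ₁ x := by
  have h1 := h.psi_neg hz hx hxz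
  rw [elasticity, neg_div, ← div_neg, div_le_div_iff₀ (by linarith) (by linarith)]
  nlinarith [h.neg_psi_le hx]

lemma four_le_elasticity_add (h : IsGammaLike G ψ ψ₁) {x z : ℝ} (hz : ψ z = 0) (hz' : z ≤ 3 / 2)
    (hx : 1 ≤ x) (hxz : x < z) :
    4 ≤ elasticity ψ ψ₁ x + elasticity ψ ψ₁ (1 / x) := by
  have hx0 : 0 < x := by linarith
  have h3 : 1 / x ≤ 1 := by rw [div_le_one hx0]; exact hx
  have h1 := h.le_elasticity hz hz' hx0 hxz
  have h2 := h.le_elasticity hz hz' (one_div_pos.2 hx0) (by linarith)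
  have h4 : (1 / x) / (3 / 2 - 1 / x) = 2 / (3 * x - 2) := by
    have : 3 * x - 2 ≠ 0 := by nlinarith
    have : 3 / 2 - 1 / x ≠ 0 := by linarith
    field_simp
  have h5 : 4 ≤ x / (3 / 2 - x) + 2 / (3 * x - 2) := by
    rw [div_add_div _ _ (by linarith) (by linarith),
      le_div_iff₀ (mul_pos (by linarith) (by linarith))]
    nlinarith [mul_nonneg (sub_nonneg.2 hx) (sub_nonneg.2 hx)]
  linarith

/-! ### The sign of `θ(x) - θ(1/x)` with `θ = x ψ / G` -/

lemma theta_lt_of_zero_le (h : IsGammaLike G ψ ψ₁) {x z : ℝ} (hz : ψ z = 0) (hz1 : 1 < z)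
    (hxz : z ≤ x) : 1 / x * ψ (1 / x) / G (1 / x) < x * ψ x / G x := by
  have hx0 : 0 < x := by linarith
  have h3 : 1 / x < 1 := by rw [div_lt_one hx0]; linarith
  have hi := one_div_pos.2 hx0
  have h1 : 0 ≤ ψ x := by
    rcases hxz.eq_or_lt with rfl | hlt
    · exact hz.ge
    · exact (h.psi_pos hz (by linarith) hlt).le
  have h2 : ψ (1 / x) < 0 := h.psi_neg hz hi (by linarith)
  calc _ < 0 := div_neg_of_neg_of_pos (mul_neg_of_pos_of_neg hi h2) (h.pos _ hi)
    _ ≤ _ := div_nonneg (mul_nonneg hx0.le h1) (h.pos x hx0).le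

/-- The logarithm of `|θ|`, on the interval where `θ` is negative. -/
lemma hasDerivAt_log_neg_theta (h : IsGammaLike G ψ ψ₁) {x z : ℝ} (hz : ψ z = 0)
    (hx : 0 < x) (hxz : x < z) :
    HasDerivAt (fun s => Real.log (-(s * ψ s / G s)))
      ((1 - elasticity ψ ψ₁ x - x * ψ x) / x) x := by
  have h1 := (h.psi_neg hz hx hxz).ne
  have h2 := (h.pos x hx).ne'
  have h3 := (((hasDerivAt_id x).mul (h.hasDerivAt_psi x hx)).div (h.hasDerivAt x hx) h2).neg.log
    (by simp [hx.ne', h1, h2])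
  convert! h3 using 1
  simp only [id, elasticity, Pi.neg_apply, Pi.div_apply, Pi.mul_apply]
  field_simp
  ring

lemma theta_sign (h : IsGammaLike G ψ ψ₁) {x z : ℝ} (hz : ψ z = 0) (hx : 1 < x) (hxz : x < z) :
    (1 / x * ψ (1 / x) / G (1 / x) < x * ψ x / G x ↔
      Real.log (-(x * ψ x / G x)) - Real.log (-(1 / x * ψ (1 / x) / G (1 / x))) < 0) ∧
    (x * ψ x / G x < 1 / x * ψ (1 / x) / G (1 / x) ↔
      0 < Real.log (-(x * ψ x / G x)) - Real.log (-(1 / x * ψ (1 / x) / G (1 / x)))) := by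
  have hneg : ∀ s, 0 < s → s < z → 0 < -(s * ψ s / G s) := fun s hs hsz => by
    have := div_neg_of_neg_of_pos (mul_neg_of_pos_of_neg hs (h.psi_neg hz hs hsz)) (h.pos s hs)
    linarith
  have hx0 : 0 < x := by linarith
  have h3 : 1 / x < 1 := by rw [div_lt_one hx0]; linarith
  have a := hneg x hx0 hxz
  have b := hneg (1 / x) (one_div_pos.2 hx0) (by linarith)
  rw [sub_neg, sub_pos, Real.log_lt_log_iff a b, Real.log_lt_log_iff b a, neg_lt_neg_iff,
    neg_lt_neg_iff]
  exact ⟨Iff.rfl, Iff.rfl⟩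

lemma theta_lt_of_kappa_neg (h : IsGammaLike G ψ ψ₁) {z : ℝ} (hz : ψ z = 0) (hz1 : 1 < z)
    (hk : ∀ x ∈ Ioo 1 z, 1 - elasticity ψ ψ₁ x - x * ψ x +
      (1 - elasticity ψ ψ₁ (1 / x) - 1 / x * ψ (1 / x)) < 0) {x : ℝ} (hx : 1 < x) :
    1 / x * ψ (1 / x) / G (1 / x) < x * ψ x / G x := by
  rcases le_or_gt z x with hxz | hxz
  · exact h.theta_lt_of_zero_le hz hz1 hxz
  rw [(h.theta_sign hz hx hxz).1]
  have hm := strictMonoOn_sub_comp_inv (b := z)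
    (f := fun s => -Real.log (-(s * ψ s / G s)))
    (g := fun x => -(1 - elasticity ψ ψ₁ x - x * ψ x))
    (fun s hs => by
      have := (h.hasDerivAt_log_neg_theta hz
        ((one_div_pos.2 (by linarith : (0 : ℝ) < z)).trans hs.1) hs.2).neg
      rwa [← neg_div] at this)
    (fun s hs => by linarith [hk s hs])
  have := hm (left_mem_Ico.2 hz1) ⟨hx.le, hxz⟩ hx
  simp only [div_one] at this
  linarith

/-- Under the bound `x ψ(x) > -1`, the inequality `N(x) + N(1/x) ≥ 4` for the elasticity `N` of `ψ`
makes the logarithmic derivative of `|θ(x)| / |θ(1/x)|` negative. -/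
lemma theta_lt_of_neg_one_lt (h : IsGammaLike G ψ ψ₁) (hb : ∀ x, 1 / 2 < x → -1 < x * ψ x)
    {x : ℝ} (hx : 1 < x) : 1 / x * ψ (1 / x) / G (1 / x) < x * ψ x / G x := by
  obtain ⟨z, hz1, hz2, hz⟩ := h.exists_zero
  refine h.theta_lt_of_kappa_neg hz hz1 (fun s hs => ?_) hx
  have hs0 : (0 : ℝ) < s := by linarith [hs.1]
  have h1 := h.four_le_elasticity_add hz hz2 hs.1.le hs.2
  have h2 := hb s (by linarith [hs.1])
  have h3 := hb (1 / s) (by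
    rw [div_lt_div_iff₀ (by norm_num) hs0]; linarith [hs.2])
  linarith

end IsGammaLike

/-! ### The case in which `x ψ` is convex -/

/-- The additional properties of the `q`-gamma functions with `q > 1`: `ψ' = ψ₁` is
logarithmically convex, and `x ψ` is convex on `[2/3, ∞)`. -/
structure IsConvexGammaLike (G ψ ψ₁ ψ₂ ψ₃ : ℝ → ℝ) : Prop extends IsGammaLike G ψ ψ₁ where
  hasDerivAt_psi₁ : ∀ x, 0 < x → HasDerivAt ψ₁ (ψ₂ x) x
  hasDerivAt_psi₂ : ∀ x, 0 < x → HasDerivAt ψ₂ (ψ₃ x) x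
  sq_le : ∀ x, 0 < x → ψ₂ x ^ 2 ≤ ψ₁ x * ψ₃ x
  convex : ∀ x, 2 / 3 ≤ x → 0 ≤ 2 * ψ₁ x + x * ψ₂ x

namespace IsConvexGammaLike

variable {G ψ ψ₁ ψ₂ ψ₃ : ℝ → ℝ}

lemma elasticity_le_two (h : IsConvexGammaLike G ψ ψ₁ ψ₂ ψ₃) {x : ℝ} (hx : 2 / 3 ≤ x) :
    elasticity ψ₁ ψ₂ x ≤ 2 := by
  rw [elasticity, div_le_iff₀ (h.psi₁_pos x (by linarith))]
  linarith [h.convex x hx]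

lemma monotoneOn_sq_mul_psi₁ (h : IsConvexGammaLike G ψ ψ₁ ψ₂ ψ₃) :
    MonotoneOn (fun x => x ^ 2 * ψ₁ x) (Ici (2 / 3)) := by
  have hd : ∀ x, 0 < x → HasDerivAt (fun x => x ^ 2 * ψ₁ x) (x * (2 * ψ₁ x + x * ψ₂ x)) x :=
    fun x hx => by
      convert! (hasDerivAt_pow 2 x).mul (h.hasDerivAt_psi₁ x hx) using 1
      push_cast
      ring
  have h0 : ∀ x ∈ Ici (2 / 3 : ℝ), 0 < x := fun x hx => by linarith [mem_Ici.1 hx]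
  refine monotoneOn_of_deriv_nonneg (convex_Ici _)
    (fun x hx => (hd x (h0 x hx)).continuousAt.continuousWithinAt)
    (fun x hx => (hd x (h0 x (interior_subset hx))).differentiableAt.differentiableWithinAt)
    fun x hx => ?_
  have hx' := interior_subset hx
  rw [(hd x (h0 x hx')).deriv]
  exact mul_nonneg (h0 x hx').le (h.convex x hx')

lemma hasDerivAt_mul_psi (h : IsConvexGammaLike G ψ ψ₁ ψ₂ ψ₃) {x : ℝ} (hx : 0 < x) :
    HasDerivAt (fun x => x * ψ x) ((x * ψ x + x ^ 2 * ψ₁ x) / x) x := by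
  convert! (hasDerivAt_id x).mul (h.hasDerivAt_psi x hx) using 1
  simp only [id]
  field_simp

lemma mul_inv_mem {x z : ℝ} (hz' : z ≤ 3 / 2) (hx : x ∈ Ioo 1 z) :
    0 < x ∧ x < 3 / 2 ∧ 2 / 3 ≤ 1 / x ∧ 1 / x < 1 := by
  have h0 : 0 < x := by linarith [hx.1]
  refine ⟨h0, by linarith [hx.2], ?_, ?_⟩
  · rw [le_div_iff₀ h0]; linarith [hx.2]
  · rw [div_lt_one h0]; exact hx.1

lemma pos_of_mem {x z : ℝ} (hz1 : 1 < z) (hx : x ∈ Ioo (1 / z) z) : 0 < x :=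
  (one_div_pos.2 (by linarith : (0 : ℝ) < z)).trans hx.1

/-- The function `x ψ(x) + ψ(1/x) / x` has a positive derivative; written out, this compares the
logarithmic derivatives `x ψ + x² ψ₁` at `x` and at `1/x`. -/
lemma mul_psi_deriv_lt (h : IsConvexGammaLike G ψ ψ₁ ψ₂ ψ₃) {z : ℝ} (hz1 : 1 < z)
    (hz' : z ≤ 3 / 2) {x : ℝ} (hx : x ∈ Ioo 1 z) :
    1 / x * ψ (1 / x) + (1 / x) ^ 2 * ψ₁ (1 / x) < x * ψ x + x ^ 2 * ψ₁ x := by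
  have hm := strictMonoOn_sub_comp_inv (b := z) (f := fun x => x * ψ x + x ^ 2 * ψ₁ x)
    (g := fun x => x * ψ x + 3 * x ^ 2 * ψ₁ x + x ^ 3 * ψ₂ x)
    (fun s hs => by
      have hs0 := pos_of_mem hz1 hs
      convert! (h.hasDerivAt_mul_psi hs0).add
        ((hasDerivAt_pow 2 s).mul (h.hasDerivAt_psi₁ s hs0)) using 1
      field_simp
      push_cast
      ring)
    (fun s hs => by
      obtain ⟨h0, h1, h2, h3⟩ := mul_inv_mem hz' hs
      have key : ∀ s, 2 / 3 ≤ s →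
          s * ψ₁ s * (2 * s - 3 / 2) ≤ s * ψ s + 3 * s ^ 2 * ψ₁ s + s ^ 3 * ψ₂ s := fun s hs' => by
        have hs0 : 0 < s := by linarith
        have e1 := mul_nonneg hs0.le (by linarith [h.neg_psi_le hs0] :
          0 ≤ ψ s + (3 / 2 - s) * ψ₁ s)
        have e2 := mul_nonneg (sq_nonneg s) (h.convex s hs')
        linarith
      have k1 := key s (by linarith [hs.1])
      have k2 := key (1 / s) h2
      have hp := h.psi₁_pos s h0
      have hp' := h.psi₁_pos (1 / s) (by linarith)
      have hsp : 0 < s * ψ₁ s := mul_pos h0 hp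
      rcases le_total (3 / 2) (2 * (1 / s)) with hc | hc
      · have : 0 ≤ 1 / s * ψ₁ (1 / s) * (2 * (1 / s) - 3 / 2) :=
          mul_nonneg (mul_pos (by linarith) hp').le (by linarith)
        have : 0 < s * ψ₁ s * (2 * s - 3 / 2) := mul_pos hsp (by linarith [hs.1])
        linarith
      · have hmono := h.monotoneOn_sq_mul_psi₁ (mem_Ici.2 h2)
          (mem_Ici.2 (by linarith [hs.1] : 2 / 3 ≤ s)) (by linarith [hs.1])
        simp only at hmono
        have e1 : 1 / s * ψ₁ (1 / s) * (2 * (1 / s) - 3 / 2) =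
            (1 / s) ^ 2 * ψ₁ (1 / s) * (2 - 3 / 2 * s) := by
          field_simp
        have hc' : 2 - 3 / 2 * s ≤ 0 := by
          have := mul_le_mul_of_nonneg_right hc h0.le
          rw [mul_assoc, one_div_mul_cancel h0.ne'] at this
          linarith
        have e2 := mul_le_mul_of_nonpos_right hmono hc'
        have e3 : 0 < s * ψ₁ s * (2 * s - 3 / 2 + s * (2 - 3 / 2 * s)) :=
          mul_pos hsp (by nlinarith [hs.1])
        nlinarith)
  have := hm (left_mem_Ico.2 hz1) ⟨hx.1.le, hx.2⟩ hx.1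
  simp only [div_one] at this
  linarith

/-- The difference of the elasticities of `ψ` and of `ψ₁` is larger at `x` than at `1/x`. -/
lemma elasticity_diff_le (h : IsConvexGammaLike G ψ ψ₁ ψ₂ ψ₃) {z : ℝ} (hz : ψ z = 0)
    (hz1 : 1 < z) (hz' : z ≤ 3 / 2) {x : ℝ} (hx : x ∈ Ioo 1 z) :
    elasticity ψ ψ₁ (1 / x) - elasticity ψ₁ ψ₂ (1 / x) ≤
      elasticity ψ ψ₁ x - elasticity ψ₁ ψ₂ x := by
  have hm := monotoneOn_sub_comp_inv (b := z)
    (f := fun x => elasticity ψ ψ₁ x - elasticity ψ₁ ψ₂ x)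
    (g := fun x => elasticity ψ ψ₁ x * (1 + elasticity ψ ψ₁ x) - x ^ 2 * ψ₂ x / ψ x -
      (elasticity ψ₁ ψ₂ x * (1 + elasticity ψ₁ ψ₂ x) - x ^ 2 * ψ₃ x / ψ₁ x))
    (fun s hs => by
      have hs0 := pos_of_mem hz1 hs
      rw [sub_div]
      exact (hasDerivAt_elasticity hs0 (h.hasDerivAt_psi s hs0) (h.hasDerivAt_psi₁ s hs0)
        (h.psi_neg hz hs0 hs.2).ne).sub (hasDerivAt_elasticity hs0 (h.hasDerivAt_psi₁ s hs0)
          (h.hasDerivAt_psi₂ s hs0) (h.psi₁_pos s hs0).ne'))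
    (fun s hs => by
      obtain ⟨h0, h1, h2, h3⟩ := mul_inv_mem hz' hs
      -- With `N`, `R` the two elasticities, the derivative is at least `(1 + N) (N - R)`, by
      -- logarithmic convexity of `ψ₁`, hence at least `(1 + N) (N - 2)`.
      have key : ∀ s, 2 / 3 ≤ s → s < z →
          elasticity ψ ψ₁ s ^ 2 - elasticity ψ ψ₁ s - 2 ≤
          elasticity ψ ψ₁ s * (1 + elasticity ψ ψ₁ s) - s ^ 2 * ψ₂ s / ψ s -
            (elasticity ψ₁ ψ₂ s * (1 + elasticity ψ₁ ψ₂ s) - s ^ 2 * ψ₃ s / ψ₁ s) :=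
        fun s hs' hsz => by
          have hs0 : 0 < s := by linarith
          have hp := h.psi₁_pos s hs0
          have hn := h.psi_neg hz hs0 hsz
          have e1 : s ^ 2 * ψ₂ s / ψ s = elasticity ψ ψ₁ s * elasticity ψ₁ ψ₂ s := by
            have := hn.ne
            simp only [elasticity]
            field_simp
          have e2 : elasticity ψ₁ ψ₂ s ^ 2 ≤ s ^ 2 * ψ₃ s / ψ₁ s := by
            rw [elasticity, div_pow, div_le_div_iff₀ (by positivity) hp]
            have := mul_le_mul_of_nonneg_left (h.sq_le s hs0)
              (mul_nonneg (sq_nonneg s) hp.le)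
            linarith
          have e3 := h.elasticity_le_two hs'
          have e4 : 0 ≤ elasticity ψ ψ₁ s :=
            le_trans (div_nonneg hs0.le (by linarith)) (h.le_elasticity hz hz' hs0 hsz)
          rw [e1]
          nlinarith
      have k1 := key s (by linarith [hs.1]) hs.2
      have k2 := key (1 / s) h2 (by linarith)
      have k3 := h.four_le_elasticity_add hz hz' hs.1.le hs.2
      nlinarith [sq_nonneg (elasticity ψ ψ₁ s - elasticity ψ ψ₁ (1 / s))])
  have := hm (left_mem_Ico.2 hz1) ⟨hx.1.le, hx.2⟩ hx.1.le
  simp only [div_one] at this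
  linarith

lemma two_le_elasticity (h : IsConvexGammaLike G ψ ψ₁ ψ₂ ψ₃) {z : ℝ} (hz : ψ z = 0)
    (hz' : z ≤ 3 / 2) {x : ℝ} (hx : 1 ≤ x) (hxz : x < z) : 2 ≤ elasticity ψ ψ₁ x := by
  refine le_trans ?_ (h.le_elasticity hz hz' (by linarith) hxz)
  rw [le_div_iff₀ (by linarith)]
  linarith

/-- With `N` the elasticity of `ψ`, the function `(1 - 1 / N) / x` is increasing, because `x ψ` is
convex. -/
lemma elasticity_inv_le (h : IsConvexGammaLike G ψ ψ₁ ψ₂ ψ₃) {z : ℝ} (hz : ψ z = 0)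
    (hz1 : 1 < z) (hz' : z ≤ 3 / 2) {x : ℝ} (hx : x ∈ Ioo 1 z) :
    elasticity ψ ψ₁ (1 / x) ≤ elasticity ψ ψ₁ x := by
  obtain ⟨h0, h1, h2, h3⟩ := mul_inv_mem hz' hx
  have hd : ∀ s, 0 < s → HasDerivAt (fun s => 1 / s + ψ s / (s ^ 2 * ψ₁ s))
      (-ψ s * (2 * ψ₁ s + s * ψ₂ s) / (s ^ 3 * ψ₁ s ^ 2)) s := fun s hs => by
    have hp := (h.psi₁_pos s hs).ne'
    have hi : HasDerivAt (fun s : ℝ => 1 / s) (-(s ^ 2)⁻¹) s := by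
      simpa using hasDerivAt_inv hs.ne'
    convert! hi.add ((h.hasDerivAt_psi s hs).div
      ((hasDerivAt_pow 2 s).mul (h.hasDerivAt_psi₁ s hs)) (by simp [hs.ne', hp])) using 1
    simp only [Pi.mul_apply]
    field_simp
    push_cast
    ring
  have hm : MonotoneOn (fun s => 1 / s + ψ s / (s ^ 2 * ψ₁ s)) (Icc (1 / x) x) := by
    have hs0 : ∀ s ∈ Icc (1 / x) x, 0 < s := fun s hs => by linarith [hs.1]
    refine monotoneOn_of_deriv_nonneg (convex_Icc _ _)
      (fun s hs => (hd s (hs0 s hs)).continuousAt.continuousWithinAt)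
      (fun s hs => (hd s (hs0 s (interior_subset hs))).differentiableAt.differentiableWithinAt)
      fun s hs => ?_
    have hs' := interior_subset hs
    rw [(hd s (hs0 s hs')).deriv]
    have := h.psi_neg hz (hs0 s hs') (by linarith [hs'.2, hx.2])
    exact div_nonneg (mul_nonneg (by linarith) (h.convex s (by linarith [hs'.1])))
      (mul_nonneg (pow_nonneg (hs0 s hs').le 3) (sq_nonneg _))
  have hle : 1 / x ≤ x := by linarith [hx.1]
  have key := hm (left_mem_Icc.2 hle) (right_mem_Icc.2 hle) hle
  simp only at key
  have eq : ∀ s, 0 < s → s < z → 1 / s + ψ s / (s ^ 2 * ψ₁ s) =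
      (1 - 1 / elasticity ψ ψ₁ s) / s := fun s hs hsz => by
    have hp := (h.psi₁_pos s hs).ne'
    have hn := (h.psi_neg hz hs hsz).ne
    simp only [elasticity]
    field_simp
    ring
  rw [eq x h0 hx.2, eq (1 / x) (by linarith) (by linarith [hx.1, hx.2])] at key
  have hN := h.two_le_elasticity hz hz' hx.1.le hx.2
  set N := elasticity ψ ψ₁ x
  set n := elasticity ψ ψ₁ (1 / x)
  have hn0 : 0 < n := lt_of_lt_of_le (div_pos (by linarith) (by linarith))
    (h.le_elasticity hz hz' (by linarith : 0 < 1 / x) (by linarith [hx.1, hx.2]))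
  have hN1 : 0 ≤ 1 - 1 / N := by
    rw [sub_nonneg, div_le_one (by linarith)]; linarith
  rw [div_div_eq_mul_div, div_one, le_div_iff₀ h0] at key
  rw [← one_div_le_one_div (by linarith) hn0]
  by_contra! hlt
  have hp : 0 < 1 - 1 / n := by linarith
  nlinarith [mul_pos hp (by nlinarith [hx.1] : 0 < x * x - 1)]

/-- The function `κ(x) + κ(1/x)`, with `κ = 1 - N - x ψ` the logarithmic derivative of `|x ψ / G|`,
is strictly decreasing to the left of the zero of `ψ`. -/
lemma strictAntiOn_kappa_add (h : IsConvexGammaLike G ψ ψ₁ ψ₂ ψ₃) {z : ℝ} (hz : ψ z = 0)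
    (hz1 : 1 < z) (hz' : z ≤ 3 / 2) :
    StrictAntiOn (fun x => 1 - elasticity ψ ψ₁ x - x * ψ x +
      (1 - elasticity ψ ψ₁ (1 / x) - 1 / x * ψ (1 / x))) (Ico 1 z) := by
  have hm := strictMonoOn_add_comp_inv (b := z) (f := fun x => elasticity ψ ψ₁ x + x * ψ x)
    (g := fun x => elasticity ψ ψ₁ x * (1 + elasticity ψ ψ₁ x) - x ^ 2 * ψ₂ x / ψ x +
      (x * ψ x + x ^ 2 * ψ₁ x))
    (fun s hs => by
      have hs0 := pos_of_mem hz1 hs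
      rw [add_div]
      exact (hasDerivAt_elasticity hs0 (h.hasDerivAt_psi s hs0) (h.hasDerivAt_psi₁ s hs0)
        (h.psi_neg hz hs0 hs.2).ne).add (h.hasDerivAt_mul_psi hs0))
    (fun s hs => by
      obtain ⟨h0, h1, h2, h3⟩ := mul_inv_mem hz' hs
      have e : ∀ s, 0 < s → s < z →
          s ^ 2 * ψ₂ s / ψ s = elasticity ψ ψ₁ s * elasticity ψ₁ ψ₂ s := fun s hs hsz => by
        have hn := (h.psi_neg hz hs hsz).ne
        have hp := (h.psi₁_pos s hs).ne'
        simp only [elasticity]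
        field_simp
      rw [e s h0 hs.2, e (1 / s) (by linarith) (by linarith)]
      have k1 := h.mul_psi_deriv_lt hz1 hz' hs
      have k2 := h.elasticity_diff_le hz hz1 hz' hs
      have k3 := h.elasticity_inv_le hz hz1 hz' hs
      have k4 := h.two_le_elasticity hz hz' hs.1.le hs.2
      have k5 := h.elasticity_le_two (by linarith [hs.1] : 2 / 3 ≤ s)
      have k6 : 0 ≤ elasticity ψ ψ₁ (1 / s) :=
        le_trans (div_nonneg (by linarith) (by linarith))
          (h.le_elasticity hz hz' (by linarith : 0 < 1 / s) (by linarith))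
      nlinarith [mul_nonneg (sub_nonneg.2 k3)
        (by linarith : 0 ≤ 1 + (elasticity ψ ψ₁ s - elasticity ψ₁ ψ₂ s)),
        mul_nonneg k6 (sub_nonneg.2 k2)])
  intro x hx y hy hxy
  have := hm hx hy hxy
  simp only at this ⊢
  linarith

lemma theta_lt_of_kappa_one_nonpos (h : IsConvexGammaLike G ψ ψ₁ ψ₂ ψ₃)
    (hk : 0 ≤ ψ 1 - ψ 1 ^ 2 + ψ₁ 1) {x : ℝ} (hx : 1 < x) :
    1 / x * ψ (1 / x) / G (1 / x) < x * ψ x / G x := by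
  obtain ⟨z, hz1, hz2, hz⟩ := h.exists_zero
  have hm := h.strictAntiOn_kappa_add hz hz1 hz2
  have hn := h.psi_neg hz one_pos hz1
  have h0 : 1 - elasticity ψ ψ₁ 1 - ψ 1 ≤ 0 := by
    have : 1 - elasticity ψ ψ₁ 1 - ψ 1 = (ψ 1 - ψ 1 ^ 2 + ψ₁ 1) / ψ 1 := by
      have := hn.ne
      simp only [elasticity]
      field_simp
      ring
    rw [this]
    exact div_nonpos_of_nonneg_of_nonpos hk hn.le
  refine h.theta_lt_of_kappa_neg hz hz1 (fun s hs => ?_) hx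
  have := hm (left_mem_Ico.2 hz1) ⟨hs.1.le, hs.2⟩ hs.1
  simp only [div_one, one_mul] at this
  linarith

/-- If `κ(1) > 0`, then `θ(x) - θ(1/x)` changes sign exactly once on `(1, ∞)`: near `1` it is
negative, at the zero of `ψ` it is positive, and in between Rolle's theorem locates the only zero of
`κ(x) + κ(1/x)`. -/
lemma exists_theta_sign_change (h : IsConvexGammaLike G ψ ψ₁ ψ₂ ψ₃)
    (hk : ψ 1 - ψ 1 ^ 2 + ψ₁ 1 < 0) {z : ℝ} (hz1 : 1 < z) (hz : ψ z = 0) :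
    ∃ y, 1 < y ∧ y < z ∧
      (∀ x, 1 < x → x < y → x * ψ x / G x < 1 / x * ψ (1 / x) / G (1 / x)) ∧
      (∀ x, y < x → 1 / x * ψ (1 / x) / G (1 / x) < x * ψ x / G x) := by
  have hz2 : z ≤ 3 / 2 := by
    obtain ⟨w, hw1, hw2, hw⟩ := h.exists_zero
    rwa [h.strictMonoOn_psi.injOn (mem_Ioi.2 (by linarith : (0 : ℝ) < z))
      (mem_Ioi.2 (by linarith : (0 : ℝ) < w)) (hz.trans hw.symm)]
  have hm := h.strictAntiOn_kappa_add hz hz1 hz2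
  have hn := h.psi_neg hz one_pos hz1
  have h0 : 0 < 1 - elasticity ψ ψ₁ 1 - ψ 1 := by
    have : 1 - elasticity ψ ψ₁ 1 - ψ 1 = (ψ 1 - ψ 1 ^ 2 + ψ₁ 1) / ψ 1 := by
      have := hn.ne
      simp only [elasticity]
      field_simp
      ring
    rw [this]
    exact div_pos_of_neg_of_neg hk hn
  set σ : ℝ → ℝ := fun x => 1 - elasticity ψ ψ₁ x - x * ψ x +
      (1 - elasticity ψ ψ₁ (1 / x) - 1 / x * ψ (1 / x)) with hσ
  set D : ℝ → ℝ := fun x =>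
    Real.log (-(x * ψ x / G x)) - Real.log (-(1 / x * ψ (1 / x) / G (1 / x))) with hD
  have hd : ∀ x ∈ Ico 1 z, HasDerivAt D (σ x / x) x := fun x hx => by
    have h' := one_div_mem_Ioo_of_mem_Ico hx
    exact HasDerivAt.sub_comp_inv (g := fun x => 1 - elasticity ψ ψ₁ x - x * ψ x) h'.2.2
      (h.hasDerivAt_log_neg_theta hz h'.2.2 hx.2)
      (h.hasDerivAt_log_neg_theta hz (one_div_pos.2 h'.2.2) h'.1.2)
  have hD1 : D 1 = 0 := by simp [hD]
  have hσ1 : 0 < σ 1 := by simp only [hσ, div_one, one_mul]; linarith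
  -- `D` is positive immediately to the right of `1`
  obtain ⟨a, ha1, haz, haD⟩ : ∃ a, 1 < a ∧ a < z ∧ 0 < D a := by
    have hs := (hd 1 (left_mem_Ico.2 hz1)).hasDerivWithinAt (s := Ioi 1)
    rw [div_one, hasDerivWithinAt_iff_tendsto_slope' self_notMem_Ioi] at hs
    have e := (hs.eventually (lt_mem_nhds hσ1)).and (Ioo_mem_nhdsGT hz1)
    obtain ⟨a, ha, ha1, haz⟩ := e.exists
    refine ⟨a, ha1, haz, ?_⟩
    rw [slope_def_field, hD1, sub_zero] at ha
    exact (div_pos_iff_of_pos_right (by linarith)).1 ha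
  obtain ⟨y, hy, hyθ⟩ : ∃ y ∈ Ioo a z,
      y * ψ y / G y - 1 / y * ψ (1 / y) / G (1 / y) = 0 := by
    have hc : ∀ s, 0 < s → ContinuousAt (fun s => s * ψ s / G s) s := fun s hs =>
      (continuousAt_id.mul (h.hasDerivAt_psi s hs).continuousAt).div
        (h.hasDerivAt s hs).continuousAt (h.pos s hs).ne'
    have hcont : ContinuousOn
        (fun y => y * ψ y / G y - 1 / y * ψ (1 / y) / G (1 / y)) (Icc a z) := fun s hs => by
      have hs0 : 0 < s := by linarith [hs.1]
      have hi : ContinuousAt (fun s : ℝ => 1 / s) s :=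
        continuousAt_const.div continuousAt_id hs0.ne'
      exact ((hc s hs0).sub
        ((hc (1 / s) (one_div_pos.2 hs0)).comp' hi)).continuousWithinAt
    refine intermediate_value_Ioo haz.le hcont ⟨?_, ?_⟩
    · exact sub_neg.2 ((h.theta_sign hz ha1 haz).2.2 haD)
    · exact sub_pos.2 (h.theta_lt_of_zero_le hz hz1 le_rfl)
  have hy1 : 1 < y := ha1.trans hy.1
  have hDy : D y = 0 := by simp only [hD, sub_eq_zero.1 hyθ, sub_self]
  obtain ⟨c, hc, hc0⟩ := exists_hasDerivAt_eq_zero (f := D) (f' := fun x => σ x / x) hy1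
    (fun s hs => (hd s ⟨hs.1, hs.2.trans_lt hy.2⟩).continuousAt.continuousWithinAt)
    (by rw [hD1, hDy]) (fun s hs => hd s ⟨hs.1.le, hs.2.trans hy.2⟩)
  have hcz : c < z := hc.2.trans hy.2
  have hσc : σ c = 0 := by
    rcases div_eq_zero_iff.1 hc0 with h' | h'
    · exact h'
    · linarith [hc.1]
  have hup : StrictMonoOn D (Icc 1 c) := by
    refine strictMonoOn_of_deriv_pos (convex_Icc 1 c) (fun s hs =>
      (hd s ⟨hs.1, hs.2.trans_lt hcz⟩).continuousAt.continuousWithinAt) fun s hs => ?_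
    rw [interior_Icc] at hs
    rw [(hd s ⟨hs.1.le, hs.2.trans hcz⟩).deriv]
    refine div_pos ?_ (by linarith [hs.1])
    rw [← hσc]
    exact hm ⟨hs.1.le, hs.2.trans hcz⟩ ⟨hc.1.le, hcz⟩ hs.2
  have hdown : StrictAntiOn D (Ico c z) := by
    refine strictAntiOn_of_deriv_neg (convex_Ico c z) (fun s hs =>
      (hd s ⟨hc.1.le.trans hs.1, hs.2⟩).continuousAt.continuousWithinAt) fun s hs => ?_
    rw [interior_Ico] at hs
    rw [(hd s ⟨hc.1.le.trans hs.1.le, hs.2⟩).deriv]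
    refine div_neg_of_neg_of_pos ?_ (by linarith [hs.1, hc.1])
    rw [← hσc]
    exact hm ⟨hc.1.le, hcz⟩ ⟨hc.1.le.trans hs.1.le, hs.2⟩ hs.1
  refine ⟨y, hy1, hy.2, fun x hx hxy => ?_, fun x hxy => ?_⟩
  · refine (h.theta_sign hz hx (hxy.trans hy.2)).2.2 ?_
    change 0 < D x
    rcases le_or_gt x c with hxc | hxc
    · rw [← hD1]
      exact hup (left_mem_Icc.2 hc.1.le) ⟨hx.le, hxc⟩ hx
    · rw [← hDy]
      exact hdown ⟨hxc.le, hxy.trans hy.2⟩ ⟨hc.2.le, hy.2⟩ hxy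
  · rcases le_or_gt z x with hxz | hxz
    · exact h.theta_lt_of_zero_le hz hz1 hxz
    · refine (h.theta_sign hz (hy1.trans hxy) hxz).1.2 ?_
      change D x < 0
      rw [← hDy]
      exact hdown ⟨hc.2.le, hy.2⟩ ⟨hc.2.le.trans hxy.le, hxz⟩ hxy

end IsConvexGammaLike

/-! ### Monotonicity of the harmonic mean -/

lemma fq_one_div (q x : ℝ) : fq q (1 / x) = fq q x := by
  simp only [fq, one_div_one_div]
  ring

lemma strictMonoOn_comp_rpow {f : ℝ → ℝ} {s : Set ℝ} {t : Set ℝ} {x : ℝ} (hx : 1 < x)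
    (hf : StrictMonoOn f s) (h : ∀ α ∈ t, x ^ α ∈ s) : StrictMonoOn (fun α => f (x ^ α)) t :=
  fun _ ha _ hb hab => hf (h _ ha) (h _ hb) (Real.rpow_lt_rpow_of_exponent_lt hx hab)

lemma strictAntiOn_comp_rpow {f : ℝ → ℝ} {s : Set ℝ} {t : Set ℝ} {x : ℝ} (hx : 1 < x)
    (hf : StrictAntiOn f s) (h : ∀ α ∈ t, x ^ α ∈ s) : StrictAntiOn (fun α => f (x ^ α)) t :=
  fun _ ha _ hb hab => hf (h _ ha) (h _ hb) (Real.rpow_lt_rpow_of_exponent_lt hx hab)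

lemma gq_one_div {q x : ℝ} (hx : 0 < x) (α : ℝ) : gq q (1 / x) α = gq q x α := by
  rw [gq, gq, Real.div_rpow zero_le_one hx.le, Real.one_rpow, fq_one_div]

lemma rpow_one_div_base {x : ℝ} (hx : 0 < x) (α : ℝ) : (1 / x) ^ α = 1 / x ^ α := by
  rw [Real.div_rpow zero_le_one hx.le, Real.one_rpow]

namespace IsGammaLike

variable {q : ℝ} {ψ ψ₁ : ℝ → ℝ}

lemma fq_one (h : IsGammaLike (qGamma q) ψ ψ₁) : fq q 1 = 1 / 2 := by
  simp only [fq, div_one, h.one]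
  norm_num

lemma fq_eq (h : IsGammaLike (qGamma q) ψ ψ₁) {x : ℝ} (hx : 0 < x) :
    fq q x = (1 / qGamma q x + 1 / qGamma q (1 / x))⁻¹ := by
  have h1 := (h.pos x hx).ne'
  have h2 := (h.pos _ (one_div_pos.2 hx)).ne'
  rw [fq, one_div_add_one_div h1 h2, inv_div]

lemma hasDerivAt_inv_fq (h : IsGammaLike (qGamma q) ψ ψ₁) {x : ℝ} (hx : 0 < x) :
    HasDerivAt (fun x => 1 / qGamma q x + 1 / qGamma q (1 / x))
      ((1 / x * ψ (1 / x) / qGamma q (1 / x) - x * ψ x / qGamma q x) / x) x := by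
  have hd : ∀ s, 0 < s →
      HasDerivAt (fun s => 1 / qGamma q s) (-(s * ψ s / qGamma q s) / s) s := fun s hs => by
    have := (h.pos s hs).ne'
    convert! (hasDerivAt_const s (1 : ℝ)).div (h.hasDerivAt s hs) this using 1
    field_simp
    ring
  convert! HasDerivAt.add_comp_inv (g := fun s => -(s * ψ s / qGamma q s)) hx (hd x hx)
    (hd _ (one_div_pos.2 hx)) using 2
  ring

lemma strictMonoOn_fq (h : IsGammaLike (qGamma q) ψ ψ₁) {s : Set ℝ} (hs : Convex ℝ s)
    (h0 : ∀ x ∈ s, 0 < x) (hlt : ∀ x ∈ interior s,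
      1 / x * ψ (1 / x) / qGamma q (1 / x) < x * ψ x / qGamma q x) : StrictMonoOn (fq q) s := by
  have hm : StrictAntiOn (fun x => 1 / qGamma q x + 1 / qGamma q (1 / x)) s := by
    refine strictAntiOn_of_deriv_neg hs (fun x hx =>
      (h.hasDerivAt_inv_fq (h0 x hx)).continuousAt.continuousWithinAt) fun x hx => ?_
    have hx0 := h0 x (interior_subset hx)
    rw [(h.hasDerivAt_inv_fq hx0).deriv]
    exact div_neg_of_neg_of_pos (sub_neg.2 (hlt x hx)) hx0
  intro x hx y hy hxy
  rw [h.fq_eq (h0 x hx), h.fq_eq (h0 y hy)]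
  have hp := add_pos (one_div_pos.2 (h.pos y (h0 y hy)))
    (one_div_pos.2 (h.pos _ (one_div_pos.2 (h0 y hy))))
  exact (inv_lt_inv₀ (hp.trans (hm hx hy hxy)) hp).2 (hm hx hy hxy)

lemma strictAntiOn_fq (h : IsGammaLike (qGamma q) ψ ψ₁) {s : Set ℝ} (hs : Convex ℝ s)
    (h0 : ∀ x ∈ s, 0 < x) (hlt : ∀ x ∈ interior s,
      x * ψ x / qGamma q x < 1 / x * ψ (1 / x) / qGamma q (1 / x)) : StrictAntiOn (fq q) s := by
  have hm : StrictMonoOn (fun x => 1 / qGamma q x + 1 / qGamma q (1 / x)) s := by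
    refine strictMonoOn_of_deriv_pos hs (fun x hx =>
      (h.hasDerivAt_inv_fq (h0 x hx)).continuousAt.continuousWithinAt) fun x hx => ?_
    have hx0 := h0 x (interior_subset hx)
    rw [(h.hasDerivAt_inv_fq hx0).deriv]
    exact div_pos (sub_pos.2 (hlt x hx)) hx0
  intro x hx y hy hxy
  rw [h.fq_eq (h0 x hx), h.fq_eq (h0 y hy)]
  have hp := add_pos (one_div_pos.2 (h.pos x (h0 x hx)))
    (one_div_pos.2 (h.pos _ (one_div_pos.2 (h0 x hx))))
  exact (inv_lt_inv₀ (hp.trans (hm hx hy hxy)) hp).2 (hm hx hy hxy)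

end IsGammaLike

/-- Reflection `x ↦ 1/x` reverses monotonicity of `f_q`. -/
lemma strictAntiOn_fq_of_strictMonoOn {q : ℝ} {s t : Set ℝ} (h : StrictMonoOn (fq q) s)
    (ht : ∀ x ∈ t, 0 < x ∧ 1 / x ∈ s) : StrictAntiOn (fq q) t := fun x hx y hy hxy => by
  rw [← fq_one_div q x, ← fq_one_div q y]
  exact h (ht y hy).2 (ht x hx).2 (one_div_lt_one_div_of_lt (ht x hx).1 hxy)

lemma strictMonoOn_fq_of_strictAntiOn {q : ℝ} {s t : Set ℝ} (h : StrictAntiOn (fq q) s)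
    (ht : ∀ x ∈ t, 0 < x ∧ 1 / x ∈ s) : StrictMonoOn (fq q) t := fun x hx y hy hxy => by
  rw [← fq_one_div q x, ← fq_one_div q y]
  exact h (ht y hy).2 (ht x hx).2 (one_div_lt_one_div_of_lt (ht x hx).1 hxy)

/-- To study `g_{q,x}` on a set of exponents `α` determined by a reciprocally symmetric condition on
`x ^ α`, it suffices to take `x > 1`, as `g_{q,1/x} = g_{q,x}`. -/
lemma gq_wlog {q x : ℝ} (hx : 0 < x) (hx1 : x ≠ 1) {S : Set ℝ}
    (hS : ∀ u, 0 < u → (1 / u ∈ S ↔ u ∈ S)) :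
    ∃ w, 1 < w ∧ gq q x = gq q w ∧
      {α : ℝ | 0 < α ∧ x ^ α ∈ S} = {α : ℝ | 0 < α ∧ w ^ α ∈ S} := by
  rcases hx1.lt_or_gt with h | h
  · refine ⟨1 / x, (one_lt_div hx).2 h, funext fun α => (gq_one_div hx α).symm, ?_⟩
    ext α
    simp only [mem_ofPred_eq, rpow_one_div_base hx, hS _ (Real.rpow_pos_of_pos hx α)]
  · exact ⟨x, h, rfl, rfl⟩

lemma gq_one_eq (q : ℝ) : gq q 1 = fun _ => fq q 1 := by
  ext α
  simp [gq]

/-- The conclusions when `f_q` increases on `[1, ∞)`. -/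
lemma fq_gq_of_strictMonoOn {q : ℝ} (hm : StrictMonoOn (fq q) (Ici 1)) (h1 : fq q 1 = 1 / 2) :
    StrictAntiOn (fq q) (Ioc 0 1) ∧
      StrictMonoOn (fq q) (Ici 1) ∧
      (∀ x : ℝ, 0 < x → MonotoneOn (gq q x) (Ioi 0)) ∧
      (∀ x : ℝ, 0 < x → x ≠ 1 → StrictMonoOn (gq q x) (Ioi 0)) ∧
      (∀ x : ℝ, 0 < x → 1 ≤ 2 * fq q x ∧ (2 * fq q x = 1 ↔ x = 1)) := by
  have hg : ∀ x : ℝ, 0 < x → x ≠ 1 → StrictMonoOn (gq q x) (Ioi 0) := fun x hx hx1 => by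
    obtain ⟨w, hw, h2, -⟩ := gq_wlog (q := q) hx hx1 (S := univ) (by simp)
    rw [h2]
    exact strictMonoOn_comp_rpow hw hm fun α hα => Real.one_le_rpow hw.le (le_of_lt hα)
  have hlt : ∀ x, 0 < x → x ≠ 1 → 1 < 2 * fq q x := fun x hx hx1 => by
    have : ∀ u, 1 < u → 1 < 2 * fq q u := fun u hu => by
      have := hm self_mem_Ici (mem_Ici.2 hu.le) hu
      linarith
    rcases hx1.lt_or_gt with h | h
    · rw [← fq_one_div]
      exact this _ ((one_lt_div hx).2 h)
    · exact this x h
  refine ⟨strictAntiOn_fq_of_strictMonoOn hm fun x hx => ⟨hx.1, (one_le_div hx.1).2 hx.2⟩, hm,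
    fun x hx => ?_, hg, fun x hx => ?_⟩
  · rcases eq_or_ne x 1 with rfl | hx1
    · rw [gq_one_eq]
      exact monotoneOn_const
    · exact (hg x hx hx1).monotoneOn
  · rcases eq_or_ne x 1 with rfl | hx1
    · rw [h1]
      norm_num
    · exact ⟨(hlt x hx hx1).le, fun h => absurd h (hlt x hx hx1).ne', fun h => absurd h hx1⟩

/-- The conclusions when `f_q` decreases on `[1, y]` and increases on `[y, ∞)`. -/
lemma fq_gq_of_sign_change {q y : ℝ} (hy : 1 < y) (ha : StrictAntiOn (fq q) (Icc 1 y))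
    (hm : StrictMonoOn (fq q) (Ici y)) :
    StrictAntiOn (fq q) (Ioc 0 (1 / y)) ∧
      StrictMonoOn (fq q) (Icc (1 / y) 1) ∧
      StrictAntiOn (fq q) (Icc 1 y) ∧
      StrictMonoOn (fq q) (Ici y) ∧
      (∀ x : ℝ, 0 < x →
        AntitoneOn (gq q x) {α : ℝ | 0 < α ∧ x ^ α ∈ Icc (1 / y) y} ∧
        MonotoneOn (gq q x) {α : ℝ | 0 < α ∧ x ^ α ∈ Ioc 0 (1 / y) ∪ Ici y}) ∧
      (∀ x : ℝ, 0 < x → x ≠ 1 →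
        StrictAntiOn (gq q x) {α : ℝ | 0 < α ∧ x ^ α ∈ Icc (1 / y) y} ∧
        StrictMonoOn (gq q x) {α : ℝ | 0 < α ∧ x ^ α ∈ Ioc 0 (1 / y) ∪ Ici y}) ∧
      (∀ x : ℝ, 0 < x → fq q y ≤ fq q x) := by
  have hy0 : 0 < y := by linarith
  have hg : ∀ x : ℝ, 0 < x → x ≠ 1 →
      StrictAntiOn (gq q x) {α : ℝ | 0 < α ∧ x ^ α ∈ Icc (1 / y) y} ∧
      StrictMonoOn (gq q x) {α : ℝ | 0 < α ∧ x ^ α ∈ Ioc 0 (1 / y) ∪ Ici y} :=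
    fun x hx hx1 => by
      constructor
      · obtain ⟨w, hw, h2, h3⟩ := gq_wlog (q := q) hx hx1 (S := Icc (1 / y) y) fun u hu => by
          rw [mem_Icc, mem_Icc, one_div_le_one_div hy0 hu, one_div_le hu hy0, and_comm]
        rw [h2, h3]
        exact strictAntiOn_comp_rpow hw ha fun α hα =>
          ⟨Real.one_le_rpow hw.le hα.1.le, hα.2.2⟩
      · obtain ⟨w, hw, h2, h3⟩ := gq_wlog (q := q) hx hx1 (S := Ioc 0 (1 / y) ∪ Ici y)
          fun u hu => by
            simp only [mem_union, mem_Ioc, mem_Ici, hu, one_div_pos, true_and,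
              one_div_le_one_div hu hy0, le_one_div hy0 hu]
            exact or_comm
        rw [h2, h3]
        refine strictMonoOn_comp_rpow hw hm fun α hα => ?_
        rcases hα.2 with h | h
        · have h4 : 1 < w ^ α := Real.one_lt_rpow hw hα.1
          have h5 : 1 / y < 1 := (div_lt_one hy0).2 hy
          linarith [h.2]
        · exact h
  have hmin : ∀ x, 1 ≤ x → fq q y ≤ fq q x := fun x hx => by
    rcases le_total x y with h | h
    · exact ha.antitoneOn ⟨hx, h⟩ ⟨hy.le, le_rfl⟩ h
    · exact hm.monotoneOn self_mem_Ici h h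
  refine ⟨strictAntiOn_fq_of_strictMonoOn hm fun x hx => ⟨hx.1, ?_⟩,
    strictMonoOn_fq_of_strictAntiOn ha fun x hx => ?_, ha, hm, fun x hx => ?_, hg, fun x hx => ?_⟩
  · exact (le_one_div hy0 hx.1).2 hx.2
  · have hx0 : 0 < x := (one_div_pos.2 hy0).trans_le hx.1
    exact ⟨hx0, (one_le_div hx0).2 hx.2, (one_div_le hx0 hy0).2 hx.1⟩
  · rcases eq_or_ne x 1 with rfl | hx1
    · rw [gq_one_eq]
      exact ⟨antitoneOn_const, monotoneOn_const⟩
    · exact ⟨(hg x hx hx1).1.antitoneOn, (hg x hx hx1).2.monotoneOn⟩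
  · rcases le_total 1 x with h | h
    · exact hmin x h
    · rw [← fq_one_div q x]
      exact hmin _ ((one_le_div hx).2 h)

/-! ### The exponential series of the `q`-gamma functions -/

/-- The series `∑ k^m e^{-kλx} / (k (1 - e^{-kλ}))` over `k ≥ 1`, written with `k + 1` in place of
`k`. For `m = 0` and `e^{-λ} = q < 1` it is `-∑ log (1 - q^{n+x})`, and differentiation in `x`
raises `m` by one, up to the factor `-λ`. -/
noncomputable def qSeries (lam : ℝ) (m : ℕ) (x : ℝ) : ℝ :=
  ∑' k : ℕ, ((k : ℝ) + 1) ^ m * Real.exp (-(((k : ℝ) + 1) * lam * x)) /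
    (((k : ℝ) + 1) * (1 - Real.exp (-(((k : ℝ) + 1) * lam))))

section
variable {lam : ℝ}

lemma one_sub_exp_pos (hl : 0 < lam) : 0 < 1 - Real.exp (-lam) :=
  sub_pos.2 (Real.exp_lt_one_iff.2 (by linarith))

lemma one_sub_exp_le (hl : 0 < lam) (k : ℕ) :
    1 - Real.exp (-lam) ≤ 1 - Real.exp (-(((k : ℝ) + 1) * lam)) := by
  have : lam ≤ ((k : ℝ) + 1) * lam := le_mul_of_one_le_left hl.le (by simp)
  gcongr

lemma one_sub_exp_mul_pos (hl : 0 < lam) (k : ℕ) :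
    0 < 1 - Real.exp (-(((k : ℝ) + 1) * lam)) :=
  (one_sub_exp_pos hl).trans_le (one_sub_exp_le hl k)

lemma qSeries_term_pos (hl : 0 < lam) (m : ℕ) (x : ℝ) (k : ℕ) :
    0 < ((k : ℝ) + 1) ^ m * Real.exp (-(((k : ℝ) + 1) * lam * x)) /
      (((k : ℝ) + 1) * (1 - Real.exp (-(((k : ℝ) + 1) * lam)))) := by
  have := one_sub_exp_mul_pos hl k
  positivity

lemma exp_mul_eq_pow (c : ℝ) (k : ℕ) :
    Real.exp (-(((k : ℝ) + 1) * c)) = Real.exp (-c) ^ (k + 1) := by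
  rw [← Real.exp_nat_mul]
  push_cast
  ring_nf

lemma summable_pow_mul_exp {c : ℝ} (hc : 0 < c) (m : ℕ) :
    Summable fun k : ℕ => ((k : ℝ) + 1) ^ m * Real.exp (-(((k : ℝ) + 1) * c)) := by
  have h := summable_pow_mul_geometric_of_norm_lt_one m (r := Real.exp (-c)) (by
    rw [Real.norm_eq_abs, abs_of_pos (Real.exp_pos _)]
    exact Real.exp_lt_one_iff.2 (by linarith))
  have h2 := (summable_nat_add_iff 1).2 h
  refine h2.congr fun k => ?_
  rw [exp_mul_eq_pow]
  push_cast
  rfl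

lemma qSeries_term_le (hl : 0 < lam) (m : ℕ) (x : ℝ) (k : ℕ) :
    ((k : ℝ) + 1) ^ m * Real.exp (-(((k : ℝ) + 1) * lam * x)) /
      (((k : ℝ) + 1) * (1 - Real.exp (-(((k : ℝ) + 1) * lam)))) ≤
    (1 - Real.exp (-lam))⁻¹ * (((k : ℝ) + 1) ^ m * Real.exp (-(((k : ℝ) + 1) * (lam * x)))) := by
  have h0 := one_sub_exp_pos hl
  rw [div_eq_inv_mul, ← mul_assoc ((k : ℝ) + 1) lam x]
  gcongr
  calc 1 - Real.exp (-lam) ≤ 1 - Real.exp (-(((k : ℝ) + 1) * lam)) := one_sub_exp_le hl k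
    _ ≤ _ := le_mul_of_one_le_left (one_sub_exp_mul_pos hl k).le (by simp)

lemma summable_qSeries (hl : 0 < lam) (m : ℕ) {x : ℝ} (hx : 0 < x) :
    Summable fun k : ℕ => ((k : ℝ) + 1) ^ m * Real.exp (-(((k : ℝ) + 1) * lam * x)) /
      (((k : ℝ) + 1) * (1 - Real.exp (-(((k : ℝ) + 1) * lam)))) :=
  Summable.of_nonneg_of_le (fun k => (qSeries_term_pos hl m x k).le)
    (qSeries_term_le hl m x) ((summable_pow_mul_exp (mul_pos hl hx) m).mul_left _)

lemma hasSum_qSeries (hl : 0 < lam) (m : ℕ) {x : ℝ} (hx : 0 < x) :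
    HasSum (fun k : ℕ => ((k : ℝ) + 1) ^ m * Real.exp (-(((k : ℝ) + 1) * lam * x)) /
      (((k : ℝ) + 1) * (1 - Real.exp (-(((k : ℝ) + 1) * lam))))) (qSeries lam m x) :=
  (summable_qSeries hl m hx).hasSum

lemma qSeries_pos (hl : 0 < lam) (m : ℕ) {x : ℝ} (hx : 0 < x) : 0 < qSeries lam m x :=
  (summable_qSeries hl m hx).tsum_pos (fun k => (qSeries_term_pos hl m x k).le) 0
    (qSeries_term_pos hl m x 0)

lemma qSeries_anti (hl : 0 < lam) (m : ℕ) {x y : ℝ} (hx : 0 < x) (hxy : x ≤ y) :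
    qSeries lam m y ≤ qSeries lam m x := by
  refine Summable.tsum_le_tsum (fun k => ?_) (summable_qSeries hl m (hx.trans_le hxy))
    (summable_qSeries hl m hx)
  have := one_sub_exp_mul_pos hl k
  gcongr

lemma hasDerivAt_qSeries (hl : 0 < lam) (m : ℕ) {x : ℝ} (hx : 0 < x) :
    HasDerivAt (qSeries lam m) (-lam * qSeries lam (m + 1) x) x := by
  have hx2 : 0 < x / 2 := by linarith
  have key := hasDerivAt_tsum_of_isPreconnected
    (g := fun (k : ℕ) (y : ℝ) => ((k : ℝ) + 1) ^ m * Real.exp (-(((k : ℝ) + 1) * lam * y)) /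
      (((k : ℝ) + 1) * (1 - Real.exp (-(((k : ℝ) + 1) * lam)))))
    (g' := fun (k : ℕ) (y : ℝ) => -lam * (((k : ℝ) + 1) ^ (m + 1) *
      Real.exp (-(((k : ℝ) + 1) * lam * y)) /
      (((k : ℝ) + 1) * (1 - Real.exp (-(((k : ℝ) + 1) * lam))))))
    (t := Ioi (x / 2)) (y₀ := x) (y := x)
    ((summable_qSeries hl (m + 1) hx2).mul_left lam) isOpen_Ioi isPreconnected_Ioi
    (fun k y _ => by
      have h1 : HasDerivAt (fun y : ℝ => -(((k : ℝ) + 1) * lam * y))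
          (-(((k : ℝ) + 1) * lam)) y := by
        simpa using (hasDerivAt_id' y).const_mul (((k : ℝ) + 1) * lam) |>.fun_neg
      convert! (h1.exp.const_mul (((k : ℝ) + 1) ^ m)).div_const _ using 1
      ring)
    (fun k y hy => by
      rw [norm_mul, norm_neg, Real.norm_eq_abs, Real.norm_eq_abs, abs_of_pos hl,
        abs_of_pos (qSeries_term_pos hl (m + 1) y k)]
      have := one_sub_exp_mul_pos hl k
      have hy' := (mem_Ioi.1 hy).le
      gcongr)
    (mem_Ioi.2 (by linarith)) (summable_qSeries hl m hx) (mem_Ioi.2 (by linarith))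
  rw [tsum_mul_left] at key
  exact key

/-- Cauchy-Schwarz for three consecutive series. -/
lemma qSeries_sq_le (hl : 0 < lam) (m : ℕ) {x : ℝ} (hx : 0 < x) :
    qSeries lam (m + 1) x ^ 2 ≤ qSeries lam m x * qSeries lam (m + 2) x := by
  have hpos := qSeries_pos hl m hx
  set t := qSeries lam (m + 1) x / qSeries lam m x with ht
  have h0 := (hasSum_qSeries hl m hx).mul_left (t ^ 2)
  have h1 := (hasSum_qSeries hl (m + 1) hx).mul_left (2 * t)
  have h2 := (hasSum_qSeries hl (m + 2) hx)
  have h3 : 0 ≤ qSeries lam (m + 2) x - 2 * t * qSeries lam (m + 1) x + t ^ 2 * qSeries lam m x :=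
    ((h2.sub h1).add h0).nonneg fun k => by
      have h4 := mul_nonneg (sq_nonneg ((k : ℝ) + 1 - t)) (qSeries_term_pos hl m x k).le
      refine h4.trans_eq ?_
      ring
  have h5 : t * qSeries lam m x = qSeries lam (m + 1) x := div_mul_cancel₀ _ hpos.ne'
  have h6 := mul_nonneg hpos.le h3
  rw [← h5] at h6 ⊢
  linarith

lemma hasSum_exp_div (hl : 0 < lam) :
    HasSum (fun k : ℕ => Real.exp (-(((k : ℝ) + 1) * lam)) / ((k : ℝ) + 1))
      (-Real.log (1 - Real.exp (-lam))) := by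
  have := Real.hasSum_pow_div_log_of_abs_lt_one (x := Real.exp (-lam)) (by
    rw [abs_of_pos (Real.exp_pos _)]
    exact Real.exp_lt_one_iff.2 (by linarith))
  simpa only [exp_mul_eq_pow] using this

lemma hasSum_exp (hl : 0 < lam) :
    HasSum (fun k : ℕ => Real.exp (-(((k : ℝ) + 1) * lam)))
      (Real.exp (-lam) / (1 - Real.exp (-lam))) := by
  have := (hasSum_geometric_of_lt_one (Real.exp_pos (-lam)).le
    (Real.exp_lt_one_iff.2 (by linarith))).mul_left (Real.exp (-lam))
  simpa only [exp_mul_eq_pow, pow_succ', div_eq_mul_inv] using this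

lemma hasSum_mul_exp (hl : 0 < lam) :
    HasSum (fun k : ℕ => ((k : ℝ) + 1) * Real.exp (-(((k : ℝ) + 1) * lam)))
      (Real.exp (-lam) / (1 - Real.exp (-lam)) ^ 2) := by
  have := hasSum_coe_mul_geometric_of_norm_lt_one (r := Real.exp (-lam)) (by
    rw [Real.norm_eq_abs, abs_of_pos (Real.exp_pos _)]
    exact Real.exp_lt_one_iff.2 (by linarith))
  have h2 := (hasSum_nat_add_iff' 1).2 this
  simp only [Finset.range_one, Finset.sum_singleton, Nat.cast_zero, zero_mul, sub_zero,
    Nat.cast_add, Nat.cast_one] at h2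
  simpa only [exp_mul_eq_pow] using h2

lemma hasSum_exp_div_column (hl : 0 < lam) (x : ℝ) (k : ℕ) :
    HasSum (fun n : ℕ => Real.exp (-(((k : ℝ) + 1) * (lam * ((n : ℝ) + x)))) / ((k : ℝ) + 1))
      (((k : ℝ) + 1) ^ 0 * Real.exp (-(((k : ℝ) + 1) * lam * x)) /
      (((k : ℝ) + 1) * (1 - Real.exp (-(((k : ℝ) + 1) * lam))))) := by
  have hk : 0 < ((k : ℝ) + 1) * lam := by positivity
  have := (hasSum_geometric_of_lt_one (Real.exp_pos (-(((k : ℝ) + 1) * lam))).le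
    (Real.exp_lt_one_iff.2 (by linarith))).mul_left
      (Real.exp (-(((k : ℝ) + 1) * lam * x)) / ((k : ℝ) + 1))
  convert! this using 1
  · ext n
    rw [← Real.exp_nat_mul, div_mul_eq_mul_div, ← Real.exp_add]
    congr 2
    ring
  · have := one_sub_exp_mul_pos hl k
    field_simp

lemma hasSum_exp_div_row (hl : 0 < lam) {x : ℝ} (hx : 0 < x) (n : ℕ) :
    HasSum (fun k : ℕ => Real.exp (-(((k : ℝ) + 1) * (lam * ((n : ℝ) + x)))) / ((k : ℝ) + 1))
      (-Real.log (1 - Real.exp (-(lam * ((n : ℝ) + x))))) :=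
  hasSum_exp_div (mul_pos hl (add_pos_of_nonneg_of_pos n.cast_nonneg hx))

/-- Expanding the logarithm and summing over `n` first. -/
lemma hasSum_neg_log_one_sub_exp (hl : 0 < lam) {x : ℝ} (hx : 0 < x) :
    HasSum (fun n : ℕ => -Real.log (1 - Real.exp (-(lam * ((n : ℝ) + x))))) (qSeries lam 0 x) := by
  have hs : Summable fun a : ℕ × ℕ =>
      Real.exp (-(((a.1 : ℝ) + 1) * (lam * ((a.2 : ℝ) + x)))) / ((a.1 : ℝ) + 1) := by
    refine (summable_prod_of_nonneg fun a => by simp only [Pi.zero_apply]; positivity).2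
      ⟨fun k => (hasSum_exp_div_column hl x k).summable, ?_⟩
    simp only [fun k => (hasSum_exp_div_column hl x k).tsum_eq]
    exact summable_qSeries hl 0 hx
  have h1 := (hs.hasSum.prod_fiberwise (hasSum_exp_div_column hl x)).unique
    (hasSum_qSeries hl 0 hx)
  have h2 := (Equiv.prodComm ℕ ℕ).hasSum_iff.2 hs.hasSum
  rw [h1] at h2
  exact HasSum.prod_fiberwise (f := fun a : ℕ × ℕ =>
    Real.exp (-(((a.2 : ℝ) + 1) * (lam * ((a.1 : ℝ) + x)))) / ((a.2 : ℝ) + 1))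
    h2 (hasSum_exp_div_row hl hx)

lemma tprod_eq_exp_qSeries (hl : 0 < lam) {x : ℝ} (hx : 0 < x) :
    ∏' n : ℕ, (1 - Real.exp (-(lam * ((n : ℝ) + 1)))) / (1 - Real.exp (-(lam * ((n : ℝ) + x)))) =
      Real.exp (qSeries lam 0 x - qSeries lam 0 1) := by
  have h := (hasSum_neg_log_one_sub_exp hl hx).sub (hasSum_neg_log_one_sub_exp hl one_pos)
  have hp : ∀ y, 0 < y → ∀ n : ℕ, 0 < 1 - Real.exp (-(lam * ((n : ℝ) + y))) := fun y hy n =>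
    one_sub_exp_pos (by positivity)
  rw [← h.rexp.tprod_eq]
  refine tprod_congr fun n => ?_
  rw [Function.comp, neg_sub_neg, Real.exp_sub, Real.exp_log (hp 1 one_pos n),
    Real.exp_log (hp x hx n)]

/-- The recurrence that turns into `Γ_q(x + 1) = (1 - q^x) / (1 - q) Γ_q(x)`. -/
lemma qSeries_zero_sub (hl : 0 < lam) {x : ℝ} (hx : 0 < x) :
    qSeries lam 0 x - qSeries lam 0 (x + 1) = -Real.log (1 - Real.exp (-(lam * x))) := by
  refine ((hasSum_qSeries hl 0 hx).sub
    (hasSum_qSeries hl 0 (by linarith : 0 < x + 1))).unique ?_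
  convert! hasSum_exp_div (mul_pos hl hx) using 2 with k
  have := one_sub_exp_mul_pos hl k
  rw [← mul_assoc, mul_add, neg_add, Real.exp_add, mul_one]
  field_simp

lemma qSeries_one_sub (hl : 0 < lam) {x : ℝ} (hx : 0 < x) :
    qSeries lam 1 x - qSeries lam 1 (x + 1) =
      Real.exp (-(lam * x)) / (1 - Real.exp (-(lam * x))) := by
  refine ((hasSum_qSeries hl 1 hx).sub
    (hasSum_qSeries hl 1 (by linarith : 0 < x + 1))).unique ?_
  convert! hasSum_exp (mul_pos hl hx) using 2 with k
  have := one_sub_exp_mul_pos hl k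
  rw [← mul_assoc, mul_add, neg_add, Real.exp_add, mul_one]
  field_simp

/-! ### A common form of the `q`-gamma functions with `q ≠ 1` -/

/-- For `λ = -log q` and `a = 0` this is `Γ_q` with `q < 1`; for `λ = a = log q` it is `Γ_q` with
`q > 1`. -/
noncomputable def qGammaAux (a lam x : ℝ) : ℝ :=
  Real.exp (a * (x - 1) * (x - 2) / 2 + (1 - x) * Real.log (1 - Real.exp (-lam)) +
    (qSeries lam 0 x - qSeries lam 0 1))

/-- The logarithmic derivative of `qGammaAux a lam`. -/
noncomputable def qPsiAux (a lam x : ℝ) : ℝ :=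
  a * (x - 3 / 2) - Real.log (1 - Real.exp (-lam)) - lam * qSeries lam 1 x

lemma isGammaLike_qGammaAux {a : ℝ} (ha : 0 ≤ a) (hl : 0 < lam) :
    IsGammaLike (qGammaAux a lam) (qPsiAux a lam) (fun x => a + lam ^ 2 * qSeries lam 2 x) where
  pos _ _ := Real.exp_pos _
  hasDerivAt x hx := by
    have h1 : HasDerivAt (fun x : ℝ => x - 1) 1 x := (hasDerivAt_id x).sub_const _
    have h2 : HasDerivAt (fun x : ℝ => x - 2) 1 x := (hasDerivAt_id x).sub_const _
    have h3 : HasDerivAt (fun x : ℝ => 1 - x) (-1) x := (hasDerivAt_id x).const_sub _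
    convert! (((((h1.const_mul a).mul h2).div_const 2).add
      (h3.mul_const (Real.log (1 - Real.exp (-lam))))).add
      ((hasDerivAt_qSeries hl 0 hx).sub_const (qSeries lam 0 1))).exp using 1
    simp only [qGammaAux, qPsiAux, Pi.add_apply, Pi.mul_apply]
    ring_nf
  hasDerivAt_psi x hx := by
    have h1 : HasDerivAt (fun x : ℝ => x - 3 / 2) 1 x := (hasDerivAt_id x).sub_const _
    convert! ((h1.const_mul a).sub_const (Real.log (1 - Real.exp (-lam)))).sub
      ((hasDerivAt_qSeries hl 1 hx).const_mul lam) using 1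
    ring
  psi₁_pos x hx := add_pos_of_nonneg_of_pos ha (mul_pos (pow_pos hl 2) (qSeries_pos hl 2 hx))
  psi₁_anti x y hx hxy := by
    have := qSeries_anti hl 2 hx hxy
    gcongr
  one := by simp [qGammaAux]
  two := by
    have := qSeries_zero_sub hl one_pos
    rw [mul_one, one_add_one_eq_two] at this
    rw [qGammaAux, Real.exp_eq_one_iff]
    linarith

/-- The recurrence for the digamma function, with `ψ(x + 1) ≥ 0` for `x > 1/2`, gives the lower
bound; here `y / (e^y - 1) < 1` with `y = λ x`. -/
lemma neg_one_lt_mul_qPsiAux (hl : 0 < lam) {x : ℝ} (hx : 1 / 2 < x) :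
    -1 < x * qPsiAux 0 lam x := by
  have hx0 : 0 < x := by linarith
  have hG := isGammaLike_qGammaAux le_rfl hl
  have h1 : 0 < qPsiAux 0 lam (x + 1) := hG.psi_three_halves_nonneg.trans_lt
    (hG.strictMonoOn_psi (mem_Ioi.2 (by norm_num)) (mem_Ioi.2 (by linarith)) (by linarith))
  have h2 := qSeries_one_sub hl hx0
  have hy := mul_pos hl hx0
  have h3 := one_sub_exp_pos hy
  have h4 : lam * x * (Real.exp (-(lam * x)) / (1 - Real.exp (-(lam * x)))) < 1 := by
    rw [← mul_div_assoc, div_lt_one h3]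
    have := Real.add_one_lt_exp hy.ne'
    have e : Real.exp (lam * x) * Real.exp (-(lam * x)) = 1 := by
      rw [← Real.exp_add]; simp
    nlinarith [Real.exp_pos (-(lam * x))]
  have h5 : qPsiAux 0 lam x = qPsiAux 0 lam (x + 1) -
      lam * (Real.exp (-(lam * x)) / (1 - Real.exp (-(lam * x)))) := by
    rw [← h2, qPsiAux, qPsiAux]
    ring
  rw [h5]
  nlinarith [mul_pos hx0 h1]

end

lemma qGamma_of_lt_one {q x : ℝ} (hq : 0 < q) (hq1 : q < 1) (hx : 0 < x) :
    qGamma q x = qGammaAux 0 (-Real.log q) x := by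
  have hl : 0 < -Real.log q := neg_pos.2 (Real.log_neg hq hq1)
  have e : ∀ y, q ^ y = Real.exp (-(-Real.log q * y)) := fun y => by
    rw [Real.rpow_def_of_pos hq, neg_mul, neg_neg]
  rw [qGamma, if_pos hq1]
  simp only [e]
  rw [tprod_eq_exp_qSeries hl hx, Real.rpow_def_of_pos (by linarith), ← Real.exp_add, qGammaAux,
    neg_neg, Real.exp_log hq]
  ring_nf

lemma qGamma_of_one_lt {q x : ℝ} (hq : 1 < q) (hx : 0 < x) :
    qGamma q x = qGammaAux (Real.log q) (Real.log q) x := by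
  have hl : 0 < Real.log q := Real.log_pos hq
  have hq0 : 0 < q := by linarith
  have e : ∀ y, q ^ (-y) = Real.exp (-(Real.log q * y)) := fun y => by
    rw [Real.rpow_def_of_pos hq0, mul_neg]
  rw [qGamma, if_neg hq.le.not_gt, if_neg hq.ne']
  simp only [e]
  have h1 : Real.log (1 - Real.exp (-Real.log q)) = Real.log (q - 1) - Real.log q := by
    rw [Real.exp_neg, Real.exp_log hq0, ← Real.log_div (by linarith) hq0.ne']
    congr 1
    field_simp
  rw [tprod_eq_exp_qSeries hl hx, Real.rpow_def_of_pos (by linarith), Real.rpow_def_of_pos hq0,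
    ← Real.exp_add, ← Real.exp_add, qGammaAux, h1]
  ring_nf

lemma IsGammaLike.congr {G H ψ ψ₁ : ℝ → ℝ} (h : IsGammaLike G ψ ψ₁)
    (e : ∀ x, 0 < x → H x = G x) : IsGammaLike H ψ ψ₁ where
  pos x hx := by rw [e x hx]; exact h.pos x hx
  hasDerivAt x hx := by
    rw [e x hx]
    exact (h.hasDerivAt x hx).congr_of_eventuallyEq
      (Filter.eventually_of_mem (Ioi_mem_nhds hx) e)
  hasDerivAt_psi := h.hasDerivAt_psi
  psi₁_pos := h.psi₁_pos
  psi₁_anti := h.psi₁_anti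
  one := by rw [e 1 one_pos]; exact h.one
  two := by rw [e 2 two_pos]; exact h.two

lemma IsGammaLike.qDigamma_eq {q : ℝ} {ψ ψ₁ : ℝ → ℝ} (h : IsGammaLike (qGamma q) ψ ψ₁) {x : ℝ}
    (hx : 0 < x) : qDigamma q x = ψ x := by
  rw [qDigamma, (h.hasDerivAt x hx).deriv, mul_div_cancel_left₀ _ (h.pos x hx).ne']

lemma IsGammaLike.deriv_qDigamma {q : ℝ} {ψ ψ₁ : ℝ → ℝ} (h : IsGammaLike (qGamma q) ψ ψ₁) {x : ℝ}
    (hx : 0 < x) : deriv (qDigamma q) x = ψ₁ x :=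
  ((h.hasDerivAt_psi x hx).congr_of_eventuallyEq (Filter.eventually_of_mem (Ioi_mem_nhds hx)
    fun _ hy => h.qDigamma_eq hy)).deriv

lemma IsGammaLike.mem_setJ_iff {q : ℝ} {ψ ψ₁ : ℝ → ℝ} (h : IsGammaLike (qGamma q) ψ ψ₁)
    (hq : 0 < q) : q ∈ setJ ↔ 0 ≤ ψ 1 - ψ 1 ^ 2 + ψ₁ 1 := by
  rw [setJ, mem_ofPred_eq, h.qDigamma_eq one_pos, h.deriv_qDigamma one_pos]
  exact and_iff_right hq

/-- If `ψ(1) > -1`, then `q ∈ J`, because `|ψ(1)| ≤ ψ'(1) / 2`. -/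
lemma IsGammaLike.mem_setJ {q : ℝ} {ψ ψ₁ : ℝ → ℝ} (h : IsGammaLike (qGamma q) ψ ψ₁)
    (hq : 0 < q) (hb : -1 < ψ 1) : q ∈ setJ := by
  rw [h.mem_setJ_iff hq]
  obtain ⟨z, hz1, -, hz⟩ := h.exists_zero
  have h1 := h.psi_neg hz one_pos hz1
  have h2 := h.neg_psi_le one_pos
  nlinarith

/-! ### Convexity of `x ψ_q(x)` for `q > 1` -/

lemma div_exp_sub_one_anti {u v : ℝ} (hu : 0 < u) (huv : u ≤ v) :
    v / (Real.exp v - 1) ≤ u / (Real.exp u - 1) := by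
  have h := convexOn_exp.secant_mono (mem_univ 0) (mem_univ u) (mem_univ v) hu.ne'
    (hu.trans_le huv).ne' huv
  simp only [Real.exp_zero, sub_zero] at h
  have h1 := div_pos (sub_pos.2 (Real.one_lt_exp_iff.2 hu)) hu
  simpa only [inv_div] using inv_anti₀ h1 h

/-- The weights `y / (1 - e^{-y})` at `y = kL`; the value at `k = 0` is `0`. -/
noncomputable def qWeight (L : ℝ) (k : ℕ) : ℝ :=
  k * L / (1 - Real.exp (-(k * L)))

section
variable {L : ℝ}

lemma qWeight_eq (hL : 0 < L) {k : ℕ} (hk : k ≠ 0) :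
    qWeight L k = k * L + k * L / (Real.exp (k * L) - 1) := by
  have hk' : 0 < (k : ℝ) * L := mul_pos (by positivity) hL
  have h1 : Real.exp (k * L) - 1 ≠ 0 := (sub_pos.2 (Real.one_lt_exp_iff.2 hk')).ne'
  have h2 : Real.exp (k * L) ≠ 0 := (Real.exp_pos _).ne'
  rw [qWeight, Real.exp_neg]
  field_simp
  ring

lemma qWeight_nonneg (hL : 0 < L) (k : ℕ) : 0 ≤ qWeight L k := by
  have hk : 0 ≤ (k : ℝ) * L := by positivity
  exact div_nonneg hk (sub_nonneg.2 (Real.exp_le_one_iff.2 (by linarith)))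

/-- This holds with equality for the linear part `kL` of the weights, and the rest
`y / (e^y - 1)` is decreasing. -/
lemma qWeight_succ_le (hL : 0 < L) (k : ℕ) :
    ((k : ℝ) + 2) * qWeight L (k + 2) - k * qWeight L k ≤ 4 * qWeight L (k + 1) := by
  set b : ℕ → ℝ := fun k => k * L / (Real.exp (k * L) - 1) with hb
  have hanti : ∀ j : ℕ, j ≠ 0 → b (j + 1) ≤ b j := fun j hj =>
    div_exp_sub_one_anti (by positivity) (by push_cast; nlinarith)
  have hpos : 0 ≤ b (k + 1) :=
    div_nonneg (by positivity) (sub_nonneg.2 (Real.one_le_exp (by positivity)))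
  have h1 := hanti (k + 1) (by simp)
  have h2 : (k : ℝ) * ((k : ℝ) * L + b (k + 1)) ≤ k * qWeight L k := by
    rcases eq_or_ne k 0 with rfl | hk
    · simp
    · rw [qWeight_eq hL hk]
      have := hanti k hk
      gcongr
  rw [qWeight_eq hL (by simp : k + 1 ≠ 0), qWeight_eq hL (by simp : k + 2 ≠ 0)]
  change ((k : ℝ) + 2) * (((k + 2 : ℕ) : ℝ) * L + b (k + 2)) - _ ≤
    4 * (((k + 1 : ℕ) : ℝ) * L + b (k + 1))
  push_cast
  have h3 := mul_le_mul_of_nonneg_left h1 (by positivity : (0 : ℝ) ≤ (k : ℝ) + 2)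
  nlinarith

lemma qWeight_one_le (hL : 0 < L) : qWeight L 1 ≤ 1 + L := by
  rw [qWeight, Nat.cast_one, one_mul, div_le_iff₀ (one_sub_exp_pos hL)]
  have h1 := Real.add_one_le_exp L
  have e : Real.exp L * Real.exp (-L) = 1 := by rw [← Real.exp_add]; simp
  nlinarith [Real.exp_pos (-L)]

lemma mul_exp_neg_le_two {ρ : ℝ} (hρ : 0 < ρ) :
    (1 + 3 / 2 * ρ) * (Real.exp (-ρ) ^ 2 / 2 + Real.exp (-ρ) * ρ) ≤ 2 := by
  have h1 : 1 + ρ + ρ ^ 2 / 2 + ρ ^ 3 / 6 ≤ Real.exp ρ := by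
    have := Real.sum_le_exp_of_nonneg hρ.le 4
    simp only [Finset.sum_range_succ, Finset.sum_range_zero, Nat.factorial] at this
    norm_num at this
    linarith
  have h2 : Real.exp (-ρ) ≤ 1 := Real.exp_le_one_iff.2 (by linarith)
  have h0 := Real.exp_pos (-ρ)
  have e : Real.exp ρ * Real.exp (-ρ) = 1 := by rw [← Real.exp_add]; simp
  have h3 : (1 + 3 / 2 * ρ) * (1 / 2 + ρ) ≤ 2 * Real.exp ρ := by
    nlinarith [mul_nonneg hρ.le (sq_nonneg (ρ - 1))]
  have h4 : Real.exp (-ρ) ^ 2 / 2 + Real.exp (-ρ) * ρ ≤ Real.exp (-ρ) * (1 / 2 + ρ) := by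
    nlinarith
  calc _ ≤ (1 + 3 / 2 * ρ) * (Real.exp (-ρ) * (1 / 2 + ρ)) := by gcongr
    _ = Real.exp (-ρ) * ((1 + 3 / 2 * ρ) * (1 / 2 + ρ)) := by ring
    _ ≤ Real.exp (-ρ) * (2 * Real.exp ρ) := by gcongr
    _ = 2 := by linarith

/-- The partial sums of `∑ φ_k r^k (2 - kρ)`, `r = e^{-ρ}`, are bounded below by a telescoping sum,
through `ρ ≤ sinh ρ = (1 - r²) / (2r)`. -/
lemma qWeight_sum_ge (hL : 0 < L) {ρ : ℝ} (hρ : 0 < ρ) (n : ℕ) :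
    -(qWeight L 1 * (Real.exp (-ρ) ^ 2 / 2 + Real.exp (-ρ) * ρ)) +
      (Real.exp (-ρ) ^ (n + 1) * (((n : ℝ) + 2) * qWeight L (n + 2)) +
        Real.exp (-ρ) ^ (n + 2) * (((n : ℝ) + 1) * qWeight L (n + 1))) / 2 ≤
    ∑ k ∈ Finset.range (n + 1),
      qWeight L (k + 1) * Real.exp (-ρ) ^ (k + 1) * (2 - ((k : ℝ) + 1) * ρ) := by
  set r := Real.exp (-ρ) with hr
  have hr0 : 0 < r := Real.exp_pos _
  induction n with
  | zero =>
    have h := mul_le_mul_of_nonneg_left (qWeight_succ_le hL 0) hr0.le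
    simp only [zero_add, Finset.sum_range_one, Nat.cast_zero, zero_mul, sub_zero] at h ⊢
    linarith
  | succ n ih =>
    rw [Finset.sum_range_succ]
    have hs : 2 * (r * ρ) ≤ 1 - r ^ 2 := by
      have h1 := Real.self_le_sinh_iff.2 hρ.le
      rw [Real.sinh_eq, ← hr] at h1
      have e : Real.exp ρ * r = 1 := by rw [hr, ← Real.exp_add]; simp
      nlinarith
    have hw := qWeight_nonneg hL (n + 2)
    have h2 := mul_le_mul_of_nonneg_left hs
      (by positivity : 0 ≤ r ^ (n + 1) * (((n : ℝ) + 2) * qWeight L (n + 2)))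
    have h3 := mul_le_mul_of_nonneg_left (qWeight_succ_le hL (n + 1))
      (by positivity : 0 ≤ r ^ (n + 2))
    push_cast at h3 ⊢
    have e1 : n + 1 + 1 = n + 2 := rfl
    have e2 : n + 1 + 2 = n + 3 := rfl
    rw [e1, e2] at *
    have p1 : r ^ (n + 2) = r ^ (n + 1) * r := pow_succ _ _
    have p2 : r ^ (n + 3) = r ^ (n + 1) * r ^ 2 := by ring
    rw [p1] at h3 ih ⊢
    rw [p2]
    nlinarith

/-- Convexity of `x ψ_q(x)` for `q = e^L > 1`, expressed by the series for its second derivative. -/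
lemma convex_mul_qPsiAux (hL : 0 < L) {x : ℝ} (hx : 2 / 3 ≤ x) :
    0 ≤ 2 * (L + L ^ 2 * qSeries L 2 x) + x * (-L ^ 3 * qSeries L 3 x) := by
  have hx0 : 0 < x := by linarith
  have hρ : 0 < L * x := mul_pos hL hx0
  have hs := ((summable_qSeries hL 2 hx0).hasSum.mul_left (2 * L)).sub
    ((summable_qSeries hL 3 hx0).hasSum.mul_left (L ^ 2 * x))
  have hs' : HasSum (fun k : ℕ => qWeight L (k + 1) * Real.exp (-(L * x)) ^ (k + 1) *
      (2 - ((k : ℝ) + 1) * (L * x))) (2 * L * qSeries L 2 x - L ^ 2 * x * qSeries L 3 x) := by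
    convert! hs using 1
    ext k
    have := one_sub_exp_mul_pos hL k
    rw [qWeight, ← exp_mul_eq_pow, mul_assoc _ L x]
    push_cast
    field_simp
  have hlim := (Filter.tendsto_add_atTop_iff_nat 1).2 hs'.tendsto_sum_nat
  have hbound : (-2 : ℝ) ≤ 2 * L * qSeries L 2 x - L ^ 2 * x * qSeries L 3 x := by
    refine ge_of_tendsto' hlim fun n => le_trans ?_ (qWeight_sum_ge hL hρ n)
    have h1 := qWeight_nonneg hL (n + 1)
    have h2 := qWeight_nonneg hL (n + 2)
    have h3 : qWeight L 1 ≤ 1 + 3 / 2 * (L * x) :=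
      (qWeight_one_le hL).trans (by nlinarith)
    have h4 : qWeight L 1 * (Real.exp (-(L * x)) ^ 2 / 2 + Real.exp (-(L * x)) * (L * x)) ≤
        (1 + 3 / 2 * (L * x)) *
          (Real.exp (-(L * x)) ^ 2 / 2 + Real.exp (-(L * x)) * (L * x)) := by gcongr
    have h5 := h4.trans (mul_exp_neg_le_two hρ)
    have h6 : 0 ≤ (Real.exp (-(L * x)) ^ (n + 1) * (((n : ℝ) + 2) * qWeight L (n + 2)) +
        Real.exp (-(L * x)) ^ (n + 2) * (((n : ℝ) + 1) * qWeight L (n + 1))) / 2 := by positivity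
    linarith
  have := mul_nonneg hL.le (by linarith :
    0 ≤ 2 + (2 * L * qSeries L 2 x - L ^ 2 * x * qSeries L 3 x))
  linarith

lemma isConvexGammaLike_qGammaAux (hL : 0 < L) :
    IsConvexGammaLike (qGammaAux L L) (qPsiAux L L) (fun x => L + L ^ 2 * qSeries L 2 x)
      (fun x => -L ^ 3 * qSeries L 3 x) (fun x => L ^ 4 * qSeries L 4 x) where
  toIsGammaLike := isGammaLike_qGammaAux hL.le hL
  hasDerivAt_psi₁ x hx := by
    convert! ((hasDerivAt_qSeries hL 2 hx).const_mul (L ^ 2)).const_add L using 1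
    ring
  hasDerivAt_psi₂ x hx := by
    convert! (hasDerivAt_qSeries hL 3 hx).const_mul (-L ^ 3) using 1
    ring
  sq_le x hx := by
    have h1 := mul_le_mul_of_nonneg_left (qSeries_sq_le hL 2 hx) (by positivity : 0 ≤ L ^ 6)
    have h2 : 0 ≤ L * (L ^ 4 * qSeries L 4 x) :=
      mul_nonneg hL.le (mul_nonneg (by positivity) (qSeries_pos hL 4 hx).le)
    linarith
  convex x hx := convex_mul_qPsiAux hL hx

/-! ### Membership in `J` for `1 < q ≤ 4` -/

/-- Termwise, by `1 / (1 - e^{-y}) - 1 / y ≤ 1`. -/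
lemma log_add_mul_qSeries_le (hL : 0 < L) :
    Real.log (1 - Real.exp (-L)) + L * qSeries L 1 1 ≤
      L * (Real.exp (-L) / (1 - Real.exp (-L))) := by
  have h1 := (hasSum_qSeries hL 1 one_pos).mul_left L
  have h := hasSum_le (fun k => ?_) (h1.sub (hasSum_exp_div hL)) ((hasSum_exp hL).mul_left L)
  · linarith
  have hk : (0 : ℝ) < (k : ℝ) + 1 := by positivity
  have hy : 0 < ((k : ℝ) + 1) * L := mul_pos hk hL
  have h0 := one_sub_exp_mul_pos hL k
  simp only [mul_one, pow_one]
  set y := ((k : ℝ) + 1) * L with hyd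
  have e : Real.exp y * Real.exp (-y) = 1 := by rw [← Real.exp_add]; simp
  have hp := Real.exp_pos (-y)
  have key : y ≤ (1 + y) * (1 - Real.exp (-y)) := by
    nlinarith [Real.add_one_le_exp y]
  have h0' := h0.ne'
  generalize Real.exp (-y) = E at *
  have e2 : L * (((k : ℝ) + 1) * E / (((k : ℝ) + 1) * (1 - E))) -
      E / ((k : ℝ) + 1) = L * E -
        E * ((1 + y) * (1 - E) - y) /
          (((k : ℝ) + 1) * (1 - E)) := by
    rw [hyd]
    field_simp
    ring
  have : 0 ≤ E * ((1 + y) * (1 - E) - y) /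
          (((k : ℝ) + 1) * (1 - E)) :=
    div_nonneg (mul_nonneg hp.le (by linarith)) (mul_pos hk h0).le
  linarith

/-- Termwise, by `(y/2 - 1) / (1 - e^{-y}) + 1 / y ≥ y / 6`. -/
lemma le_mul_qSeries_two_sub (hL : 0 < L) :
    L ^ 2 / 6 * (Real.exp (-L) / (1 - Real.exp (-L)) ^ 2) ≤
      L ^ 2 / 2 * qSeries L 2 1 - (Real.log (1 - Real.exp (-L)) + L * qSeries L 1 1) := by
  have h1 := (hasSum_qSeries hL 1 one_pos).mul_left L
  have h2 := (hasSum_qSeries hL 2 one_pos).mul_left (L ^ 2 / 2)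
  have h := hasSum_le (fun k => ?_) ((hasSum_mul_exp hL).mul_left (L ^ 2 / 6))
    (h2.sub (h1.sub (hasSum_exp_div hL)))
  · rw [sub_neg_eq_add, add_comm] at h
    linarith
  have hk : (0 : ℝ) < (k : ℝ) + 1 := by positivity
  have hy : 0 < ((k : ℝ) + 1) * L := mul_pos hk hL
  have h0 := one_sub_exp_mul_pos hL k
  simp only [mul_one, pow_one]
  set y := ((k : ℝ) + 1) * L with hyd
  have e : Real.exp y * Real.exp (-y) = 1 := by rw [← Real.exp_add]; simp
  have hp := Real.exp_pos (-y)
  have hexp : 1 + y + y ^ 2 / 2 + y ^ 3 / 6 ≤ Real.exp y := by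
    have := Real.sum_le_exp_of_nonneg hy.le 4
    simp only [Finset.sum_range_succ, Finset.sum_range_zero, Nat.factorial] at this
    norm_num at this
    linarith
  have key : 0 ≤ y ^ 2 / 2 - y + (1 - y ^ 2 / 6) * (1 - Real.exp (-y)) := by
    have h3 : 0 ≤ y ^ 2 / 3 - y + 1 := by nlinarith [sq_nonneg (y - 3 / 2)]
    have h4 := mul_le_mul_of_nonneg_right hexp h3
    have h5 : 1 - y ^ 2 / 6 ≤ Real.exp y * (y ^ 2 / 3 - y + 1) := by
      refine le_trans ?_ h4
      have : 0 ≤ y ^ 5 := by positivity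
      linarith
    have h6 := mul_le_mul_of_nonneg_right h5 hp.le
    have h7 : Real.exp y * (y ^ 2 / 3 - y + 1) * Real.exp (-y) = y ^ 2 / 3 - y + 1 := by
      rw [mul_right_comm, e, one_mul]
    rw [h7] at h6
    linarith
  have h0' := h0.ne'
  generalize Real.exp (-y) = E at *
  have e2 : L ^ 2 / 2 * (((k : ℝ) + 1) ^ 2 * E / (((k : ℝ) + 1) * (1 - E))) -
      (L * (((k : ℝ) + 1) * E / (((k : ℝ) + 1) * (1 - E))) -
        E / ((k : ℝ) + 1)) - L ^ 2 / 6 * (((k : ℝ) + 1) * E) =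
      E * (y ^ 2 / 2 - y + (1 - y ^ 2 / 6) * (1 - E)) /
        (((k : ℝ) + 1) * (1 - E)) := by
    rw [hyd]
    field_simp
    ring
  rw [← sub_nonneg, e2]
  exact div_nonneg (mul_nonneg hp.le key) (mul_pos hk h0).le

/-- The second derivative of `6 sinh L - L (3 cosh L + 1)` is `-3 L cosh L`, so this function is
concave, and it is non-negative at both ends of `[0, log 4]`. -/
lemma mul_cosh_le_sinh (hL : 0 ≤ L) (hL4 : L ≤ Real.log 4) :
    L * (3 * Real.cosh L + 1) ≤ 6 * Real.sinh L := by
  have hd1 : ∀ t : ℝ, HasDerivAt (fun t => 6 * Real.sinh t - t * (3 * Real.cosh t + 1))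
      (3 * Real.cosh t - 1 - 3 * (t * Real.sinh t)) t := fun t => by
    convert! ((Real.hasDerivAt_sinh t).const_mul 6).sub
      ((hasDerivAt_id t).mul (((Real.hasDerivAt_cosh t).const_mul 3).add_const 1)) using 1
    simp only [id]
    ring
  have hd2 : ∀ t : ℝ, HasDerivAt (fun t => 3 * Real.cosh t - 1 - 3 * (t * Real.sinh t))
      (-(3 * (t * Real.cosh t))) t := fun t => by
    convert! (((Real.hasDerivAt_cosh t).const_mul 3).sub_const 1).sub
      (((hasDerivAt_id t).mul (Real.hasDerivAt_sinh t)).const_mul 3) using 1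
    simp only [id]
    ring
  have hc : ConcaveOn ℝ (Icc 0 (Real.log 4))
      (fun t => 6 * Real.sinh t - t * (3 * Real.cosh t + 1)) := by
    refine concaveOn_of_hasDerivWithinAt2_nonpos (convex_Icc _ _)
      (fun t _ => (hd1 t).continuousAt.continuousWithinAt)
      (fun t _ => (hd1 t).hasDerivWithinAt) (fun t _ => (hd2 t).hasDerivWithinAt) fun t ht => ?_
    have := (interior_subset ht).1
    have := Real.cosh_pos t
    exact neg_nonpos.2 (by positivity)
  have h4 : (0 : ℝ) ≤ Real.log 4 := Real.log_nonneg (by norm_num)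
  have h := hc.min_le_of_mem_Icc (left_mem_Icc.2 h4) (right_mem_Icc.2 h4) ⟨hL, hL4⟩
  have he : 0 ≤ 6 * Real.sinh (Real.log 4) - Real.log 4 * (3 * Real.cosh (Real.log 4) + 1) := by
    rw [Real.sinh_log (by norm_num), Real.cosh_log (by norm_num),
      show (4 : ℝ) = 2 ^ 2 by norm_num, Real.log_pow]
    have := Real.log_two_lt_d9
    norm_num
    linarith
  have h0 : (0 : ℝ) ≤ 6 * Real.sinh 0 - 0 * (3 * Real.cosh 0 + 1) := by simp
  linarith [(le_min h0 he).trans h]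

lemma qPsiAux_one_nonneg (hL : 0 < L) (hL4 : L ≤ Real.log 4) :
    0 ≤ qPsiAux L L 1 - qPsiAux L L 1 ^ 2 + (L + L ^ 2 * qSeries L 2 1) := by
  have h1 := log_add_mul_qSeries_le hL
  have h2 := le_mul_qSeries_two_sub hL
  have h3 := mul_cosh_le_sinh hL.le hL4
  have hψ : qPsiAux L L 1 =
      -(L / 2 + (Real.log (1 - Real.exp (-L)) + L * qSeries L 1 1)) := by
    rw [qPsiAux]
    ring
  rw [hψ]
  set b := Real.log (1 - Real.exp (-L)) + L * qSeries L 1 1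
  rw [Real.cosh_eq, Real.sinh_eq] at h3
  have e : Real.exp L * Real.exp (-L) = 1 := by rw [← Real.exp_add]; simp
  have hp := Real.exp_pos (-L)
  have h0 := one_sub_exp_pos hL
  set p := Real.exp (-L)
  have h3' : L * (3 + 2 * p + 3 * p ^ 2) ≤ 6 * (1 - p ^ 2) := by
    have := mul_le_mul_of_nonneg_right h3 hp.le
    nlinarith
  -- With `B = -ψ(1)`, an upper bound `B'` for `B` and a lower bound `2B + c` for `ψ'(1)`, the claim
  -- follows from `B'² ≤ B' + c`.
  have hB : L / 2 + L * (p / (1 - p)) = L / 2 * ((1 + p) / (1 - p)) := by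
    field_simp
    ring
  have hc : (L / 2 * ((1 + p) / (1 - p))) ^ 2 ≤
      L / 2 * ((1 + p) / (1 - p)) + L ^ 2 / 3 * (p / (1 - p) ^ 2) := by
    rw [← sub_nonneg]
    have : L / 2 * ((1 + p) / (1 - p)) + L ^ 2 / 3 * (p / (1 - p) ^ 2) -
        (L / 2 * ((1 + p) / (1 - p))) ^ 2 =
        L * (6 * (1 - p ^ 2) - L * (3 + 2 * p + 3 * p ^ 2)) / (12 * (1 - p) ^ 2) := by
      field_simp
      ring
    rw [this]
    exact div_nonneg (mul_nonneg hL.le (by linarith)) (by positivity)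
  have hcn : 0 ≤ L ^ 2 / 3 * (p / (1 - p) ^ 2) := by positivity
  have hB' : L / 2 + b ≤ L / 2 * ((1 + p) / (1 - p)) := by linarith
  set B' := L / 2 * ((1 + p) / (1 - p))
  set c := L ^ 2 / 3 * (p / (1 - p) ^ 2) with hcd
  have h2' : 2 * (L / 2 + b) + c ≤ L + L ^ 2 * qSeries L 2 1 := by
    rw [hcd]
    linarith
  have h5 : (L / 2 + b) ^ 2 ≤ (L / 2 + b) + c := by
    rcases le_total (L / 2 + b) 0 with hs | hs
    · have hG := isGammaLike_qGammaAux hL.le hL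
      obtain ⟨z, hz1, -, hz⟩ := hG.exists_zero
      have := hG.psi_neg hz one_pos hz1
      linarith
    rcases le_total (L / 2 + b) 1 with ht | ht
    · nlinarith
    · nlinarith
  linarith

end

/-! ### Euler's gamma function -/

/-- The terms of the logarithm of Weierstrass' product for `1 / Γ`, with opposite sign. -/
noncomputable def weierstrassTerm (m : ℕ) (x : ℝ) : ℝ :=
  x / ((m : ℝ) + 1) - Real.log (1 + x / ((m : ℝ) + 1))

/-- The terms of the series for the digamma function. -/
noncomputable def digammaTerm (m : ℕ) (x : ℝ) : ℝ :=
  1 / ((m : ℝ) + 1) - 1 / ((m : ℝ) + 1 + x)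

lemma hasDerivAt_weierstrassTerm (m : ℕ) {x : ℝ} (hx : -1 < x) :
    HasDerivAt (weierstrassTerm m) (digammaTerm m x) x := by
  have hm : (0 : ℝ) < (m : ℝ) + 1 := by positivity
  have hm0 : (0 : ℝ) ≤ m := m.cast_nonneg
  have hmx : (0 : ℝ) < (m : ℝ) + 1 + x := by linarith
  have h1 : HasDerivAt (fun x : ℝ => x / ((m : ℝ) + 1)) (1 / ((m : ℝ) + 1)) x :=
    (hasDerivAt_id x).div_const _
  have e : 1 + x / ((m : ℝ) + 1) = ((m : ℝ) + 1 + x) / ((m : ℝ) + 1) := by field_simp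
  convert! h1.sub ((h1.const_add 1).log (by rw [e]; positivity)) using 1
  rw [digammaTerm, e]
  field_simp

lemma hasDerivAt_digammaTerm (m : ℕ) {x : ℝ} (hx : 0 < x) :
    HasDerivAt (digammaTerm m) (1 / ((m : ℝ) + 1 + x) ^ 2) x := by
  have hmx : (m : ℝ) + 1 + x ≠ 0 := by positivity
  have h1 : HasDerivAt (fun x : ℝ => (m : ℝ) + 1 + x) 1 x := (hasDerivAt_id x).const_add _
  convert! ((hasDerivAt_const x (1 : ℝ)).div h1 hmx).const_sub (1 / ((m : ℝ) + 1)) using 1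
  field_simp
  ring

lemma summable_one_div_add_one_sq : Summable fun m : ℕ => 1 / ((m : ℝ) + 1) ^ 2 := by
  have := (summable_nat_add_iff 1).2 (Real.summable_one_div_nat_pow.2 one_lt_two)
  simpa using this

lemma norm_digammaTerm_le (m : ℕ) {x b : ℝ} (hx : x ∈ Ioo (-1 / 2) b) (hb : 1 / 2 ≤ b) :
    ‖digammaTerm m x‖ ≤ 2 * b * (1 / ((m : ℝ) + 1) ^ 2) := by
  have hm : (0 : ℝ) < (m : ℝ) + 1 := by positivity
  have hm0 : (0 : ℝ) ≤ m := m.cast_nonneg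
  have hmx : ((m : ℝ) + 1) / 2 ≤ (m : ℝ) + 1 + x := by linarith [hx.1]
  have hmx' : 0 < (m : ℝ) + 1 + x := by linarith
  have e : digammaTerm m x = x / (((m : ℝ) + 1) * ((m : ℝ) + 1 + x)) := by
    rw [digammaTerm]
    field_simp
    ring
  have hxb : |x| ≤ b := abs_le.2 ⟨by linarith [hx.1], hx.2.le⟩
  rw [e, Real.norm_eq_abs, abs_div, abs_of_pos (mul_pos hm hmx')]
  calc |x| / (((m : ℝ) + 1) * ((m : ℝ) + 1 + x)) ≤ b / (((m : ℝ) + 1) * (((m : ℝ) + 1) / 2)) := by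
        gcongr
    _ = _ := by field_simp

lemma weierstrass_summable_hasDerivAt {x : ℝ} (hx : 0 < x) :
    Summable (fun m => weierstrassTerm m x) ∧ Summable (fun m => digammaTerm m x) ∧
      HasDerivAt (fun x => ∑' m, weierstrassTerm m x) (∑' m, digammaTerm m x) x := by
  have hb : (1 : ℝ) / 2 ≤ x + 1 := by linarith
  have hu : Summable fun m : ℕ => 2 * (x + 1) * (1 / ((m : ℝ) + 1) ^ 2) :=
    summable_one_div_add_one_sq.mul_left _
  have hmem : x ∈ Ioo (-1 / 2) (x + 1) := ⟨by linarith, by linarith⟩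
  have h0 : (0 : ℝ) ∈ Ioo (-1 / 2) (x + 1) := ⟨by norm_num, by linarith⟩
  have hs0 : Summable fun m => weierstrassTerm m 0 := by simp [weierstrassTerm, summable_zero]
  exact ⟨summable_of_summable_hasDerivAt_of_isPreconnected hu isOpen_Ioo isPreconnected_Ioo
      (fun m y hy => hasDerivAt_weierstrassTerm m (by linarith [hy.1]))
      (fun m y hy => norm_digammaTerm_le m hy hb) h0 hs0 hmem,
    Summable.of_norm_bounded hu fun m => norm_digammaTerm_le m hmem hb,
    hasDerivAt_tsum_of_isPreconnected hu isOpen_Ioo isPreconnected_Ioo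
      (fun m y hy => hasDerivAt_weierstrassTerm m (by linarith [hy.1]))
      (fun m y hy => norm_digammaTerm_le m hy hb) h0 hs0 hmem⟩

lemma summable_one_div_add_sq {x : ℝ} (hx : 0 < x) :
    Summable fun m : ℕ => 1 / ((m : ℝ) + 1 + x) ^ 2 :=
  Summable.of_nonneg_of_le (fun m => by positivity) (fun m =>
    one_div_le_one_div_of_le (by positivity)
      (pow_le_pow_left₀ (by positivity) (by linarith) 2)) summable_one_div_add_one_sq

lemma hasDerivAt_tsum_digammaTerm {x : ℝ} (hx : 0 < x) :
    HasDerivAt (fun x => ∑' m, digammaTerm m x) (∑' m : ℕ, 1 / ((m : ℝ) + 1 + x) ^ 2) x :=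
  hasDerivAt_tsum_of_isPreconnected summable_one_div_add_one_sq isOpen_Ioi isPreconnected_Ioi
    (fun m y hy => hasDerivAt_digammaTerm m hy)
    (fun m y hy => by
      have hy' : 0 < y := hy
      rw [Real.norm_eq_abs, abs_of_pos (by positivity)]
      exact one_div_le_one_div_of_le (by positivity)
        (pow_le_pow_left₀ (by positivity) (by linarith) 2))
    (mem_Ioi.2 hx) (weierstrass_summable_hasDerivAt hx).2.1 (mem_Ioi.2 hx)

/-- Weierstrass' product, from the limit formula for `log Γ`. -/
lemma log_Gamma_eq_tsum {x : ℝ} (hx : 0 < x) :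
    Real.log (Real.Gamma x) =
      -Real.log x - Real.eulerMascheroniConstant * x + ∑' m, weierstrassTerm m x := by
  have hpart : ∀ n : ℕ, ∑ m ∈ Finset.range n, weierstrassTerm m x =
      Real.BohrMollerup.logGammaSeq x n + Real.log x + x * ((harmonic n : ℝ) - Real.log n) :=
    fun n => by
      have h1 : ∀ m : ℕ, weierstrassTerm m x = x * ((m : ℝ) + 1)⁻¹ -
          (Real.log (x + ((m + 1 : ℕ) : ℝ)) - Real.log ((m : ℝ) + 1)) := fun m => by
        have hm : (0 : ℝ) < (m : ℝ) + 1 := by positivity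
        rw [weierstrassTerm, ← Real.log_div (by positivity) hm.ne', div_eq_mul_inv]
        congr 2
        push_cast
        field_simp
        ring
      have h2 : ∀ n : ℕ, ∑ m ∈ Finset.range n, Real.log ((m : ℝ) + 1) = Real.log (n.factorial) :=
        fun n => by
          rw [← Finset.prod_range_add_one_eq_factorial, Nat.cast_prod,
            Real.log_prod (fun m _ => by positivity)]
          simp
      rw [Real.BohrMollerup.logGammaSeq, Finset.sum_range_succ', harmonic]
      simp only [h1, Finset.sum_sub_distrib, ← Finset.mul_sum, h2]
      push_cast
      simp only [add_zero]
      ring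
  have hlim := ((Real.BohrMollerup.tendsto_log_gamma hx).add_const (Real.log x)).add
    (Real.tendsto_harmonic_sub_log.const_mul x)
  have hsum := (weierstrass_summable_hasDerivAt hx).1.hasSum.tendsto_sum_nat
  simp only [hpart] at hsum
  have := tendsto_nhds_unique hsum hlim
  linarith

lemma isGammaLike_Gamma : ∃ ψ₁ : ℝ → ℝ, IsGammaLike Real.Gamma
    (fun x => -x⁻¹ - Real.eulerMascheroniConstant + ∑' m, digammaTerm m x) ψ₁ := by
  refine ⟨fun x => (x ^ 2)⁻¹ + ∑' m : ℕ, 1 / ((m : ℝ) + 1 + x) ^ 2, ?_⟩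
  refine ⟨fun x hx => Real.Gamma_pos_of_pos hx, fun x hx => ?_, fun x hx => ?_, fun x hx => ?_,
    fun x y hx hxy => ?_, Real.Gamma_one, Real.Gamma_two⟩
  · have h1 : HasDerivAt (fun x => -Real.log x - Real.eulerMascheroniConstant * x +
        ∑' m, weierstrassTerm m x)
        (-x⁻¹ - Real.eulerMascheroniConstant + ∑' m, digammaTerm m x) x := by
      simpa using ((Real.hasDerivAt_log hx.ne').fun_neg.fun_sub
        ((hasDerivAt_id' x).const_mul Real.eulerMascheroniConstant)).fun_add
        (weierstrass_summable_hasDerivAt hx).2.2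
    have h2 := h1.exp
    rw [← log_Gamma_eq_tsum hx, Real.exp_log (Real.Gamma_pos_of_pos hx)] at h2
    refine h2.congr_of_eventuallyEq (Filter.eventually_of_mem (Ioi_mem_nhds hx) fun y hy => ?_)
    simp only
    rw [← log_Gamma_eq_tsum hy, Real.exp_log (Real.Gamma_pos_of_pos hy)]
  · simpa using ((hasDerivAt_inv hx.ne').fun_neg.sub_const
      Real.eulerMascheroniConstant).fun_add (hasDerivAt_tsum_digammaTerm hx)
  · have : 0 ≤ ∑' m : ℕ, 1 / ((m : ℝ) + 1 + x) ^ 2 := tsum_nonneg fun m => by positivity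
    positivity
  · have := Summable.tsum_le_tsum (f := fun m : ℕ => 1 / ((m : ℝ) + 1 + y) ^ 2)
      (g := fun m : ℕ => 1 / ((m : ℝ) + 1 + x) ^ 2) (fun m => by gcongr)
      (summable_one_div_add_sq (hx.trans_le hxy)) (summable_one_div_add_sq hx)
    gcongr

lemma IsGammaLike.neg_one_lt_of_Gamma {ψ ψ₁ : ℝ → ℝ} (h : IsGammaLike Real.Gamma ψ ψ₁) {x : ℝ}
    (hx : 1 / 2 < x) : -1 < x * ψ x := by
  have hx0 : 0 < x := by linarith
  have h1 : 0 < ψ (x + 1) := h.psi_three_halves_nonneg.trans_lt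
    (h.strictMonoOn_psi (mem_Ioi.2 (by norm_num)) (mem_Ioi.2 (by linarith)) (by linarith))
  have h2 : HasDerivAt (fun x => Real.log (Real.Gamma (x + 1))) (ψ (x + 1)) x :=
    (h.hasDerivAt_log (by linarith : 0 < x + 1)).comp_add_const x 1
  have h3 : HasDerivAt (fun x => Real.log x + Real.log (Real.Gamma x)) (x⁻¹ + ψ x) x :=
    (Real.hasDerivAt_log hx0.ne').add (h.hasDerivAt_log hx0)
  have h4 : ψ (x + 1) = x⁻¹ + ψ x := by
    refine h2.unique (h3.congr_of_eventuallyEq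
      (Filter.eventually_of_mem (Ioi_mem_nhds hx0) fun y hy => ?_))
    have hy' : 0 < y := hy
    simp only
    rw [Real.Gamma_add_one hy'.ne', Real.log_mul hy'.ne' (Real.Gamma_pos_of_pos hy').ne']
  have h5 : x * ψ x = x * ψ (x + 1) - 1 := by
    rw [h4]
    field_simp
    ring
  rw [h5]
  linarith [mul_pos hx0 h1]

/-! ### The harmonic mean for all `q > 0` -/

lemma exists_isGammaLike_of_le_one {q : ℝ} (hq : 0 < q) (hq1 : q ≤ 1) :
    ∃ ψ ψ₁ : ℝ → ℝ, IsGammaLike (qGamma q) ψ ψ₁ ∧ ∀ x, 1 / 2 < x → -1 < x * ψ x := by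
  rcases hq1.lt_or_eq with h | rfl
  · have hl : 0 < -Real.log q := neg_pos.2 (Real.log_neg hq h)
    exact ⟨_, _, (isGammaLike_qGammaAux le_rfl hl).congr fun x hx => qGamma_of_lt_one hq h hx,
      fun x hx => neg_one_lt_mul_qPsiAux hl hx⟩
  · obtain ⟨ψ₁, h⟩ := isGammaLike_Gamma
    exact ⟨_, ψ₁, h.congr fun _ _ => by simp [qGamma], fun _ hx => h.neg_one_lt_of_Gamma hx⟩

lemma isConvexGammaLike_qGamma {q : ℝ} (hq : 1 < q) :
    IsConvexGammaLike (qGamma q) (qPsiAux (Real.log q) (Real.log q))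
      (fun x => Real.log q + Real.log q ^ 2 * qSeries (Real.log q) 2 x)
      (fun x => -Real.log q ^ 3 * qSeries (Real.log q) 3 x)
      (fun x => Real.log q ^ 4 * qSeries (Real.log q) 4 x) :=
  { isConvexGammaLike_qGammaAux (Real.log_pos hq) with
    toIsGammaLike := (isConvexGammaLike_qGammaAux (Real.log_pos hq)).toIsGammaLike.congr
      fun _ hx => qGamma_of_one_lt hq hx }

lemma IsGammaLike.exists_isPosZero {q : ℝ} {ψ ψ₁ : ℝ → ℝ} (h : IsGammaLike (qGamma q) ψ ψ₁) :
    ∃ z, 1 < z ∧ ψ z = 0 ∧ IsPosZero q z := by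
  obtain ⟨z, hz1, -, hz⟩ := h.exists_zero
  have hz0 : 0 < z := by linarith
  refine ⟨z, hz1, hz, hz0, by rw [h.qDigamma_eq hz0, hz], fun x hx hx0 => ?_⟩
  rw [h.qDigamma_eq hx] at hx0
  exact h.strictMonoOn_psi.injOn (mem_Ioi.2 hx) (mem_Ioi.2 hz0) (hx0.trans hz.symm)

lemma IsGammaLike.strictMonoOn_Ici_one {q : ℝ} {ψ ψ₁ : ℝ → ℝ} (h : IsGammaLike (qGamma q) ψ ψ₁)
    (hlt : ∀ x, 1 < x → 1 / x * ψ (1 / x) / qGamma q (1 / x) < x * ψ x / qGamma q x) :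
    StrictMonoOn (fq q) (Ici 1) :=
  h.strictMonoOn_fq (convex_Ici 1) (fun x hx => by linarith [mem_Ici.1 hx]) fun x hx => by
    rw [interior_Ici] at hx
    exact hlt x hx

lemma Ioc_zero_four_subset_setJ : Ioc (0 : ℝ) 4 ⊆ setJ := by
  rintro q ⟨hq, hq4⟩
  rcases le_or_gt q 1 with h1 | h1
  · obtain ⟨ψ, ψ₁, h, hb⟩ := exists_isGammaLike_of_le_one hq h1
    exact h.mem_setJ hq (by simpa using hb 1 (by norm_num))
  · rw [(isConvexGammaLike_qGamma h1).toIsGammaLike.mem_setJ_iff hq]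
    exact qPsiAux_one_nonneg (Real.log_pos h1) (Real.log_le_log hq hq4)

lemma strictMonoOn_fq_of_mem_setJ {q : ℝ} (hJ : q ∈ setJ) :
    StrictMonoOn (fq q) (Ici 1) ∧ fq q 1 = 1 / 2 := by
  have hq : 0 < q := hJ.1
  rcases le_or_gt q 1 with h1 | h1
  · obtain ⟨ψ, ψ₁, h, hb⟩ := exists_isGammaLike_of_le_one hq h1
    exact ⟨h.strictMonoOn_Ici_one fun x hx => h.theta_lt_of_neg_one_lt hb hx, h.fq_one⟩
  · have h := isConvexGammaLike_qGamma h1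
    rw [h.toIsGammaLike.mem_setJ_iff hq] at hJ
    exact ⟨h.toIsGammaLike.strictMonoOn_Ici_one fun x hx => h.theta_lt_of_kappa_one_nonpos hJ hx,
      h.toIsGammaLike.fq_one⟩

theorem mainTheorem1 :
    Ioc (0 : ℝ) 4 ⊆ setJ ∧
    (∀ q : ℝ, q ∈ setJ →
      StrictAntiOn (fq q) (Ioc 0 1) ∧
      StrictMonoOn (fq q) (Ici 1) ∧
      (∀ x : ℝ, 0 < x → MonotoneOn (gq q x) (Ioi 0)) ∧
      (∀ x : ℝ, 0 < x → x ≠ 1 → StrictMonoOn (gq q x) (Ioi 0)) ∧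
      (∀ x : ℝ, 0 < x → 1 ≤ 2 * fq q x ∧ (2 * fq q x = 1 ↔ x = 1))) ∧
    (∀ q : ℝ, 0 < q → q ∉ setJ →
      ∃ xq : ℝ, IsPosZero q xq ∧ ∃ y : ℝ, 1 < y ∧ y < xq ∧
        StrictAntiOn (fq q) (Ioc 0 (1 / y)) ∧
        StrictMonoOn (fq q) (Icc (1 / y) 1) ∧
        StrictAntiOn (fq q) (Icc 1 y) ∧
        StrictMonoOn (fq q) (Ici y) ∧
        (∀ x : ℝ, 0 < x →
          AntitoneOn (gq q x) {α : ℝ | 0 < α ∧ x ^ α ∈ Icc (1 / y) y} ∧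
          MonotoneOn (gq q x) {α : ℝ | 0 < α ∧ x ^ α ∈ Ioc 0 (1 / y) ∪ Ici y}) ∧
        (∀ x : ℝ, 0 < x → x ≠ 1 →
          StrictAntiOn (gq q x) {α : ℝ | 0 < α ∧ x ^ α ∈ Icc (1 / y) y} ∧
          StrictMonoOn (gq q x) {α : ℝ | 0 < α ∧ x ^ α ∈ Ioc 0 (1 / y) ∪ Ici y}) ∧
        (∀ x : ℝ, 0 < x → fq q y ≤ fq q x)) := by
  refine ⟨Ioc_zero_four_subset_setJ, fun q hJ => ?_, fun q hq hJ => ?_⟩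
  · obtain ⟨hm, h1⟩ := strictMonoOn_fq_of_mem_setJ hJ
    exact fq_gq_of_strictMonoOn hm h1
  · have hq1 : 1 < q := by
      by_contra! hle
      exact hJ (Ioc_zero_four_subset_setJ ⟨hq, by linarith⟩)
    have h := isConvexGammaLike_qGamma hq1
    rw [h.toIsGammaLike.mem_setJ_iff hq, not_le] at hJ
    obtain ⟨z, hz1, hz, hzero⟩ := h.toIsGammaLike.exists_isPosZero
    obtain ⟨y, hy1, hyz, hlt, hgt⟩ := h.exists_theta_sign_change hJ hz1 hz
    refine ⟨z, hzero, y, hy1, hyz, fq_gq_of_sign_change hy1 ?_ ?_⟩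
    · refine h.toIsGammaLike.strictAntiOn_fq (convex_Icc 1 y)
        (fun x hx => by linarith [hx.1]) fun x hx => ?_
      rw [interior_Icc] at hx
      exact hlt x hx.1 hx.2
    · refine h.toIsGammaLike.strictMonoOn_fq (convex_Ici y)
        (fun x hx => by linarith [mem_Ici.1 hx]) fun x hx => ?_
      rw [interior_Ici] at hx
      exact hgt x hx
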